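/- Assume the Riemann Hypothesis. For $X\ge 2$ let $V_X:\mathbb R\to\mathbb R$ be a continuous function such that $e^{cx}V_X(x)$ is integrable over $\mathbb R$ for every $c\ge 0$, and put $\widehat V_X(z)=\int_{-\infty}^{\infty}e^{ixz}V_X(x)\,dx$. Let $m\ge 2$ be real and suppose that, with implied constants independent of $X$, (ii) $\widehat V_X(z/i)\ll X^{\Re z}/|\Im z|^m$ as $\Im z\to\infty$, uniformly for $\Re z\ge 0$ in bounded ranges; (iii) $\frac1{\log X}\widehat V_X\big(\frac{y}{\log X}\big)\ll \frac1{1+y^2}$ for all $y\in\mathbb R$. Let $\log\zeta(s)$ denote the branch obtained by continuous variation along the horizontal ray from $+\infty+i\,\Im s$ to $s$, starting with the value $0$ at infinity, i.e. $\log\zeta(s)=-\int_{\Re s}^{\infty}\frac{\zeta'}{\zeta}(\alpha+i\,\Im s)\,d\alpha$. Fix $\epsilon>0$. Then for all sufficiently large $t\in[T,2T]$, all $X$ with $T^{\epsilon}\le X\le T^{2m}$ and all $\tfrac12\le\sigma\le1$, the series and the integral below converge absolutely and $$\sum_{n\ge2}\frac{\Lambda(n)V_X(\log n)}{n^{\sigma+it}\log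 n}=\frac1{2\pi}\int_{-1}^{1}\log\zeta(\sigma+i(y+t))\,\widehat V_X(y)\,dy+O(1),$$ where the implied constant and the threshold for $t$ depend only on $\epsilon$, $m$ and the family $(V_X)$, not on $T,t,X,\sigma$. -/

import Mathlib

noncomputable section

namespace LongSums

/-- The Fourier transform `∫ e^{ixz} v(x) dx` of a weight `v`, at a complex argument `z`. -/
def weightFT (v : ℝ → ℝ) (z : ℂ) : ℂ :=
  ∫ x : ℝ, Complex.exp (Complex.I * x * z) * (v x : ℂ)

/-- The logarithm of the zeta function defined by continuous variation along the horizontal ray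
from `+∞ + i Im s` (where it tends to `0`) to `s`, that is
`log ζ(s) = -∫_{Re s}^∞ (ζ'/ζ)(α + i Im s) dα`. The value is meaningful whenever the closed ray
meets neither a zero nor the pole of `ζ`. -/
def logZeta (s : ℂ) : ℂ :=
  -∫ α in Set.Ioi s.re,
    deriv riemannZeta (α + s.im * Complex.I) / riemannZeta (α + s.im * Complex.I)

/-- What is needed for `weightFT (V X) (z / i)`, `Re z ≥ 0`, to be given by an absolutely
convergent integral, and for the pointwise values of `V X` to be determined by its transform. -/
def WellDefinedWeights (V : ℝ → ℝ → ℝ) : Prop :=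
  ∀ X : ℝ, 2 ≤ X → Continuous (V X) ∧
    ∀ c : ℝ, 0 ≤ c → MeasureTheory.Integrable (fun x : ℝ => Real.exp (c * x) * V X x)

/-- `V̂_X(z/i) ≪ X^{Re z} / |Im z|^m` as `Im z → ∞`, for `Re z ≥ 0` in a bounded range,
uniformly in `X`. -/
def VerticalDecay (V : ℝ → ℝ → ℝ) (m : ℝ) : Prop :=
  ∀ A : ℝ, 0 ≤ A → ∃ C y₀ : ℝ, 0 < y₀ ∧ ∀ X : ℝ, 2 ≤ X → ∀ z : ℂ,
    0 ≤ z.re → z.re ≤ A → y₀ ≤ z.im →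
      ‖weightFT (V X) (z / Complex.I)‖ ≤ C * (X ^ z.re / |z.im| ^ m)

/-- `(1 / log X) V̂_X(y / log X) ≪ 1 / (1 + y²)` for all real `y`, uniformly in `X`. -/
def Concentrated (V : ℝ → ℝ → ℝ) : Prop :=
  ∃ C : ℝ, ∀ X : ℝ, 2 ≤ X → ∀ y : ℝ,
    ‖(1 / (Real.log X : ℂ)) * weightFT (V X) ((y / Real.log X : ℝ) : ℂ)‖ ≤ C * (1 / (1 + y ^ 2))

/-- The `n`-th term `Λ(n) v(log n) / (n^{σ+it} log n)`; it is `0` for `n = 0, 1`, as `Λ` vanishes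
there, so that summing over all `n` is the same as summing over `n ≥ 2`. -/
def weightedTerm (v : ℝ → ℝ) (σ t : ℝ) (n : ℕ) : ℂ :=
  ((ArithmeticFunction.vonMangoldt n : ℝ) : ℂ) * (v (Real.log n) : ℂ) /
    ((n : ℂ) ^ ((σ : ℂ) + t * Complex.I) * (Real.log n : ℂ))

end LongSums

end

open MeasureTheory Metric Set Filter Topology
open scoped ENNReal NNReal

namespace LongSums

/-! Write `W z = weightFT (V X) (z / I)` and `s = σ + it`. Fourier inversion on a line `Re z = c`
with `σ + c > 1`, together with the Dirichlet series of `log ζ`, turns the sum into `(1/2π) ∫ log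
ζ(s + c + iy) W(c + iy) dy` (`hasSum_weightedTerm`). Under RH the line can be moved to `Re z = 0`,
except near the height `y = -t`, where `s + z` meets the pole of `ζ` and the cut to its left. There
the contour stays on `Re z = c` for `|t + y| < h` and is joined to `Re z = 0` by two horizontal
segments, with `h ∈ [1, 2]`.

Around the pole `|y|` has size `T`, and `c = 1 - σ + 1 / log T` gives `X^c ≪ T^m` because `X ≤
T^(2m)`. Vertical decay therefore makes `W` bounded there. On `Re z = 0` with `|y| ≥ 1`,
concentration gives `W ≪ 1 / (log X (1 + y²))`. The weighted mean of `|log ζ|` at height `t + y` is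
`O(log t)`, and `log X ≥ ε log T`, so this part is also bounded. What remains is the integral over
`[-1, 1]`.

The mean bound for `|log ζ|` is unconditional and uniform in `σ ≥ 1/2`. It passes through the
majorant `∫_{1/2}^∞ |ζ'/ζ(u + iw)| du`, whose integral over unit intervals in `w` is essentially an
area integral of `|ζ'/ζ|` over a disc. Since `1/z` is integrable in the plane, zeros are harmless in
area mean. Removing them one at a time by Blaschke factors, and then applying Borel–Carathéodory,
bounds the area integral by the logarithm of the growth (`exists_lintegral_logDeriv_le`). RH enters
only through the holomorphy of `log ζ` to the right of `1/2`. The endpoint `σ = 1/2` is a limit of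
larger `σ`. -/

/-! ### Area integrals of logarithmic derivatives of entire functions. -/

theorem lintegral_enorm_inv_ball_lt_top (ρ : ℝ) :
    ∫⁻ z : ℂ in ball 0 ρ, ‖z⁻¹‖ₑ < ∞ := by
  have h : IntegrableOn (fun z : ℂ => z⁻¹) (ball 0 ρ) := by
    refine integrableOn_ball_of_norm_le_rpow (C := 1) (α := 1) (by simp) (by simp) ?_
      (by fun_prop)
    refine Eventually.of_forall fun z => ?_
    simp [Real.rpow_neg_one]
  exact h.2

theorem lintegral_enorm_inv_sub_le {c a : ℂ} {r d : ℝ} (h : dist c a ≤ d) :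
    ∫⁻ z : ℂ in ball c r, ‖(z - a)⁻¹‖ₑ ≤ ∫⁻ z : ℂ in ball 0 (r + d), ‖z⁻¹‖ₑ := by
  have hsub : ball c r ⊆ ball a (r + d) := ball_subset_ball' (by linarith)
  calc ∫⁻ z : ℂ in ball c r, ‖(z - a)⁻¹‖ₑ ≤ ∫⁻ z : ℂ in ball a (r + d), ‖(z - a)⁻¹‖ₑ :=
        lintegral_mono_set hsub
    _ = ∫⁻ z : ℂ in (fun z => z - a) ⁻¹' ball 0 (r + d), ‖(z - a)⁻¹‖ₑ := by
        congr 2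
        ext z
        simp [dist_eq_norm]
    _ = _ := (measurePreserving_sub_right volume a).setLIntegral_comp_preimage
        measurableSet_ball (f := fun z : ℂ => ‖z⁻¹‖ₑ) (by fun_prop)

/-- A logarithmic derivative bound from the Borel-Carathéodory theorem. -/
theorem norm_logDeriv_le_of_ne_zero {f : ℂ → ℂ} (hf : Differentiable ℂ f) {r r₂ : ℝ}
    (hr : 0 < r) (hr₂ : r < r₂) (h0 : ∀ z ∈ ball (0 : ℂ) r₂, f z ≠ 0) {M : ℝ}
    (hM : ∀ z ∈ ball (0 : ℂ) r₂, ‖f z‖ ≤ M) {z : ℂ} (hz : z ∈ ball (0 : ℂ) r) :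
    ‖logDeriv f z‖ ≤
      (2 * ((r + r₂) / 2) / (r₂ - (r + r₂) / 2)) / ((r₂ - r) / 2) *
        (1 + Real.log (M / ‖f 0‖)) := by
  have hr₂0 : 0 < r₂ := hr.trans hr₂
  have hf0 : f 0 ≠ 0 := h0 0 (mem_ball_self hr₂0)
  have hld : DifferentiableOn ℂ (logDeriv f) (ball 0 r₂) :=
    (hf.contDiff (n := 2)).differentiable_deriv_two.differentiableOn.div hf.differentiableOn h0
  obtain ⟨h, hh0, hh⟩ := hld.isExactOn_ball.with_val_at 0 0
  have hexp : ∀ w ∈ ball (0 : ℂ) r₂, f w = f 0 * Complex.exp (h w) := by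
    have hder : ∀ w ∈ ball (0 : ℂ) r₂, HasDerivAt (fun w => f w * Complex.exp (-h w)) 0 w := by
      intro w hw
      have h1 := h0 w hw
      have := (hf w).hasDerivAt.fun_mul (hh w hw).fun_neg.cexp
      refine this.congr_deriv ?_
      rw [logDeriv_apply]
      field_simp
      ring
    intro w hw
    have hc := (convex_ball (0 : ℂ) r₂).is_const_of_fderivWithin_eq_zero (𝕜 := ℂ)
      (f := fun w => f w * Complex.exp (-h w))
      (fun w hw => (hder w hw).differentiableAt.differentiableWithinAt)
      (fun w hw => by
        rw [fderivWithin_of_isOpen isOpen_ball hw, (hder w hw).hasFDerivAt.fderiv]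
        ext; simp) hw (mem_ball_self hr₂0)
    simp only [hh0, neg_zero, Complex.exp_zero, mul_one] at hc
    rw [← hc, mul_assoc, ← Complex.exp_add]
    simp
  have hM0 : ‖f 0‖ ≤ M := hM 0 (mem_ball_self hr₂0)
  have hf0' : 0 < ‖f 0‖ := norm_pos_iff.2 hf0
  have hA : 0 ≤ Real.log (M / ‖f 0‖) := Real.log_nonneg ((one_le_div hf0').2 hM0)
  have hre : MapsTo h (ball 0 r₂) {w | w.re ≤ 1 + Real.log (M / ‖f 0‖)} := by
    intro w hw
    have h1 := hM w hw
    rw [hexp w hw, norm_mul, Complex.norm_exp] at h1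
    have h2 : Real.exp (h w).re ≤ M / ‖f 0‖ := by rw [le_div_iff₀ hf0']; linarith
    have := (Real.le_log_iff_exp_le (by linarith [Real.exp_pos (h w).re])).2 h2
    -- The added `1` keeps the bound on the real part strictly positive, as Borel–Carathéodory
    -- needs, even when `log (M / ‖f 0‖) = 0`.
    simp only [mem_ofPred_eq]; linarith
  have hhd : DifferentiableOn ℂ h (ball 0 r₂) :=
    fun w hw => (hh w hw).differentiableAt.differentiableWithinAt
  -- Half of the gap between `r` and `r₂` is spent on Borel–Carathéodory for `h`, the other half on
  -- Cauchy's estimate for `h'`.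
  set r' := (r + r₂) / 2 with hr'
  have hb : ∀ w : ℂ, ‖w‖ ≤ r' → ‖h w‖ ≤ (2 * r' / (r₂ - r')) * (1 + Real.log (M / ‖f 0‖)) := by
    intro w hw
    have hwr : ‖w‖ < r₂ := by linarith
    have := Complex.borelCaratheodory_zero (by linarith) hhd hre hr₂0 (by simpa using hwr) hh0
    refine this.trans ?_
    rw [div_mul_eq_mul_div]
    have : 0 < r₂ - r' := by linarith
    rw [mul_right_comm]
    gcongr
  have hz' : ‖z‖ < r := by simpa using hz
  rw [← (hh z (ball_subset_ball hr₂.le hz)).deriv]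
  have hsub : closedBall z ((r₂ - r) / 2) ⊆ closedBall 0 r' := by
    apply closedBall_subset_closedBall'
    simp; linarith
  have := Complex.norm_deriv_le_of_forall_mem_sphere_norm_le (f := h) (c := z)
    (R := (r₂ - r) / 2) (C := (2 * r' / (r₂ - r')) * (1 + Real.log (M / ‖f 0‖))) (by linarith)
    (DifferentiableOn.diffContOnCl (hhd.mono ((closure_mono ball_subset_closedBall).trans
      (by rw [isClosed_closedBall.closure_eq]; exact hsub.trans (closedBall_subset_ball (by linarith))))))
    (fun w hw => hb w (by simpa using hsub (sphere_subset_closedBall hw)))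
  rwa [mul_div_right_comm] at this

/-- Dividing out a zero by a Blaschke factor of the disc of radius `R`. -/
theorem exists_blaschke_quotient {f : ℂ → ℂ} (hf : Differentiable ℂ f) {r R : ℝ}
    (hr : 0 < r) (hrR : r < R) {ρ : ℂ} (hρ : ‖ρ‖ < R) (hρ0 : f ρ = 0) (hf0 : f 0 ≠ 0)
    {M : ℝ} (hM : ∀ z ∈ sphere (0 : ℂ) R, ‖f z‖ ≤ M) :
    ∃ g : ℂ → ℂ, Differentiable ℂ g ∧ (∀ z ∈ sphere (0 : ℂ) R, ‖g z‖ ≤ M) ∧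
      ‖g 0‖ = ‖f 0‖ * (R / ‖ρ‖) ∧ ∀ z ∈ ball (0 : ℂ) r,
        ‖logDeriv f z‖ ≤ ‖logDeriv g z‖ + (‖(z - ρ)⁻¹‖ + 1 / (R - r)) := by
  have hR : 0 < R := hr.trans hrR
  have hρne : ρ ≠ 0 := by rintro rfl; exact hf0 hρ0
  set k := dslope f ρ with hk
  have hkd : Differentiable ℂ k := by
    rw [← differentiableOn_univ]
    exact (Complex.differentiableOn_dslope univ_mem).2 hf.differentiableOn
  have hfk : ∀ z, f z = (z - ρ) * k z := by
    intro z
    have := sub_smul_dslope f ρ z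
    rw [hρ0, sub_zero, smul_eq_mul] at this
    exact this.symm
  set b : ℂ → ℂ := fun z => (R ^ 2 - (starRingEnd ℂ) ρ * z) / R with hb
  have hbd : Differentiable ℂ b := by simp only [hb]; fun_prop
  have hRc : (R : ℂ) ≠ 0 := by exact_mod_cast hR.ne'
  refine ⟨fun z => k z * b z, hkd.mul hbd, ?_, ?_, ?_⟩
  · intro z hz
    have hzR : ‖z‖ = R := by simpa using hz
    have hzρ : 0 < ‖z - ρ‖ := by
      rw [norm_pos_iff, sub_ne_zero]; rintro rfl; linarith
    -- On the circle `z * conj z = R²`, so replacing `z - ρ` by `b z` leaves the modulus of `f`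
    -- unchanged there, while at the centre it gains the factor `R / ‖ρ‖`.
    have hbz : ‖b z‖ = ‖z - ρ‖ := by
      simp only [hb]
      have h1 : (R : ℂ) ^ 2 - (starRingEnd ℂ) ρ * z = (starRingEnd ℂ) (z - ρ) * z := by
        rw [map_sub, sub_mul, ← Complex.normSq_eq_conj_mul_self, Complex.normSq_eq_norm_sq, hzR]
        push_cast; ring
      rw [h1, norm_div, norm_mul, RCLike.norm_conj, hzR]
      simp [abs_of_pos hR, hR.ne']
    have := hM z hz
    rw [hfk z, norm_mul] at this
    rw [norm_mul, hbz, mul_comm]; exact this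
  · have h1 : ‖f 0‖ = ‖ρ‖ * ‖k 0‖ := by rw [hfk 0]; simp
    have h2 : b 0 = R := by simp only [hb]; field_simp; ring
    rw [norm_mul, h2, h1]
    have : ‖ρ‖ ≠ 0 := by simpa using hρne
    simp [abs_of_pos hR]; field_simp
  · intro z hz
    have hzr : ‖z‖ < r := by simpa using hz
    have hRr : 0 < R - r := by linarith
    -- At a zero of `f` the quotient `f' / f` takes the default value `0`, so nothing is to be
    -- shown.
    by_cases hfz : f z = 0
    · rw [logDeriv_apply, hfz, div_zero, norm_zero]; positivity
    have hz1 : z - ρ ≠ 0 := by intro h; apply hfz; rw [hfk, h, zero_mul]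
    have hz2 : k z ≠ 0 := by intro h; apply hfz; rw [hfk, h, mul_zero]
    have hnum : R * (R - r) ≤ ‖(R : ℂ) ^ 2 - (starRingEnd ℂ) ρ * z‖ := by
      have h1 := norm_sub_norm_le ((R : ℂ) ^ 2) ((starRingEnd ℂ) ρ * z)
      rw [norm_mul, RCLike.norm_conj, norm_pow] at h1
      simp only [Complex.norm_real, Real.norm_eq_abs, sq_abs] at h1
      have : ‖ρ‖ * ‖z‖ ≤ R * r := by gcongr
      nlinarith
    have hnum0 : (R : ℂ) ^ 2 - (starRingEnd ℂ) ρ * z ≠ 0 := by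
      rw [← norm_pos_iff]; exact lt_of_lt_of_le (by positivity) hnum
    have hbz : b z ≠ 0 := div_ne_zero hnum0 hRc
    have e1 : logDeriv f z = (z - ρ)⁻¹ + logDeriv k z := by
      have : f = fun z => (z - ρ) * k z := funext hfk
      rw [this, logDeriv_mul z hz1 hz2 (by fun_prop) (hkd z)]
      congr 1
      rw [logDeriv_apply]; simp
    have e2 : logDeriv (fun z => k z * b z) z = logDeriv k z + logDeriv b z :=
      logDeriv_mul z hz2 hbz (hkd z) (hbd z)
    have e3 : ‖logDeriv b z‖ ≤ 1 / (R - r) := by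
      have : HasDerivAt b (-(starRingEnd ℂ) ρ / R) z := by
        simp only [hb]
        have := ((hasDerivAt_id z).const_mul ((starRingEnd ℂ) ρ)).const_sub ((R : ℂ) ^ 2)
        simpa using this.div_const (R : ℂ)
      rw [logDeriv_apply, this.deriv]
      simp only [hb]
      rw [div_div_div_cancel_right₀ hRc, norm_div, norm_neg, RCLike.norm_conj]
      rw [div_le_div_iff₀ (norm_pos_iff.2 hnum0) hRr]
      nlinarith
    calc ‖logDeriv f z‖ = ‖logDeriv (fun z => k z * b z) z + ((z - ρ)⁻¹ - logDeriv b z)‖ := by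
          rw [e1, e2]; ring_nf
      _ ≤ _ := (norm_add_le _ _).trans (by gcongr; exact (norm_sub_le _ _).trans (by gcongr))

/-- The area integral of the logarithmic derivative of an entire function over a disc is controlled
by the logarithm of its growth. -/
theorem exists_lintegral_logDeriv_le {r r₂ R : ℝ} (hr : 0 < r) (hr₂ : r < r₂) (hR : r₂ < R) :
    ∃ K : ℝ, 0 ≤ K ∧ ∀ f : ℂ → ℂ, Differentiable ℂ f → f 0 ≠ 0 → ∀ M : ℝ,
      (∀ z ∈ sphere (0 : ℂ) R, ‖f z‖ ≤ M) →
      ∫⁻ z in ball (0 : ℂ) r, ‖logDeriv f z‖ₑ ≤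
        ENNReal.ofReal (K * (1 + Real.log (M / ‖f 0‖))) := by
  have hr₂0 : 0 < r₂ := hr.trans hr₂
  have hR0 : 0 < R := hr₂0.trans hR
  set lam := Real.log (R / r₂) with hlam
  have hlam0 : 0 < lam := Real.log_pos ((one_lt_div hr₂0).2 hR)
  set vol := (volume (ball (0 : ℂ) r)).toReal with hvol
  have hvolfin : volume (ball (0 : ℂ) r) = ENNReal.ofReal vol :=
    (ENNReal.ofReal_toReal measure_ball_lt_top.ne).symm
  set I₀ := (∫⁻ z : ℂ in ball 0 (r + R), ‖z⁻¹‖ₑ).toReal with hI₀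
  have hI₀fin : ∫⁻ z : ℂ in ball 0 (r + R), ‖z⁻¹‖ₑ = ENNReal.ofReal I₀ :=
    (ENNReal.ofReal_toReal (lintegral_enorm_inv_ball_lt_top _).ne).symm
  set C₀ := I₀ + 1 / (R - r) * vol with hC₀
  have hRr : 0 < R - r := by linarith
  have hvol0 : 0 ≤ vol := ENNReal.toReal_nonneg
  have hI₀0 : 0 ≤ I₀ := ENNReal.toReal_nonneg
  set K₁ := (2 * ((r + r₂) / 2) / (r₂ - (r + r₂) / 2)) / ((r₂ - r) / 2) with hK₁
  have hK₁0 : 0 ≤ K₁ := by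
    have h1 : 0 < r₂ - (r + r₂) / 2 := by linarith
    have h2 : 0 < (r₂ - r) / 2 := by linarith
    positivity
  have hmax : ∀ f : ℂ → ℂ, Differentiable ℂ f → ∀ M : ℝ,
      (∀ z ∈ sphere (0 : ℂ) R, ‖f z‖ ≤ M) → ∀ z ∈ closedBall (0 : ℂ) R, ‖f z‖ ≤ M := by
    intro f hf M hM z hz
    refine Complex.norm_le_of_forall_mem_frontier_norm_le (U := ball (0 : ℂ) R) isBounded_ball
      hf.diffContOnCl (fun w hw => hM w ?_) ?_
    · rwa [frontier_ball _ hR0.ne'] at hw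
    · rwa [closure_ball _ hR0.ne']
  -- `K₁ * vol` pays for the zero-free case. `C₀` is the cost of one zero, and each removal of a
  -- zero lowers `log (M / ‖f 0‖)` by at least `lam`.
  refine ⟨K₁ * vol + C₀ / lam, by positivity, ?_⟩
  set K := K₁ * vol + C₀ / lam with hK
  have hK0 : 0 ≤ K := by positivity
  -- Induction on the number of steps of size `lam` available in `log (M / ‖f 0‖)`; this replaces a
  -- count of zeros by Jensen's formula. The case `n = 0` is empty by the maximum principle.
  have key : ∀ n : ℕ, ∀ f : ℂ → ℂ, Differentiable ℂ f → f 0 ≠ 0 → ∀ M : ℝ,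
      (∀ z ∈ sphere (0 : ℂ) R, ‖f z‖ ≤ M) → Real.log (M / ‖f 0‖) < n * lam →
      ∫⁻ z in ball (0 : ℂ) r, ‖logDeriv f z‖ₑ ≤
        ENNReal.ofReal (K * (1 + Real.log (M / ‖f 0‖))) := by
    intro n
    induction n with
    | zero =>
      intro f hf hf0 M hM hlt
      have h1 := hmax f hf M hM 0 (mem_closedBall_self hR0.le)
      have h2 : 0 ≤ Real.log (M / ‖f 0‖) :=
        Real.log_nonneg ((one_le_div (norm_pos_iff.2 hf0)).2 h1)
      simp at hlt; linarith
    | succ n ih =>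
      intro f hf hf0 M hM hlt
      have hMf := hmax f hf M hM
      have hf0' : 0 < ‖f 0‖ := norm_pos_iff.2 hf0
      have hM0 : ‖f 0‖ ≤ M := hMf 0 (mem_closedBall_self hR0.le)
      have hA : 0 ≤ Real.log (M / ‖f 0‖) := Real.log_nonneg ((one_le_div hf0').2 hM0)
      by_cases hz : ∃ ρ ∈ ball (0 : ℂ) r₂, f ρ = 0
      · obtain ⟨ρ, hρ, hρ0⟩ := hz
        have hρ' : ‖ρ‖ < r₂ := by simpa using hρ
        have hρpos : 0 < ‖ρ‖ := norm_pos_iff.2 (by rintro rfl; exact hf0 hρ0)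
        obtain ⟨g, hg, hgM, hg0, hgl⟩ := exists_blaschke_quotient hf hr (hr₂.trans hR)
          (hρ'.trans hR) hρ0 hf0 hM
        have hg0' : 0 < ‖g 0‖ := by rw [hg0]; positivity
        have hMpos : 0 < M := hf0'.trans_le hM0
        have hlog : Real.log (M / ‖g 0‖) ≤ Real.log (M / ‖f 0‖) - lam := by
          rw [hlam, ← Real.log_div (by positivity) (by positivity)]
          apply Real.log_le_log (by positivity)
          rw [hg0, div_div]
          have : R / r₂ ≤ R / ‖ρ‖ := by gcongr
          gcongr
        have h1 := ih g hg (norm_pos_iff.1 hg0') M hgM (by push_cast at hlt; linarith)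
        calc ∫⁻ z in ball (0 : ℂ) r, ‖logDeriv f z‖ₑ
            ≤ ∫⁻ z in ball (0 : ℂ) r,
              (‖logDeriv g z‖ₑ + (‖(z - ρ)⁻¹‖ₑ + ENNReal.ofReal (1 / (R - r)))) := by
              refine setLIntegral_mono' measurableSet_ball fun z hz => ?_
              rw [← ofReal_norm, ← ofReal_norm, ← ofReal_norm,
                ← ENNReal.ofReal_add (by positivity) (by positivity),
                ← ENNReal.ofReal_add (by positivity) (by positivity)]
              exact ENNReal.ofReal_le_ofReal (hgl z hz)
          _ = (∫⁻ z in ball (0 : ℂ) r, ‖logDeriv g z‖ₑ) +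
              ((∫⁻ z in ball (0 : ℂ) r, ‖(z - ρ)⁻¹‖ₑ) +
                ENNReal.ofReal (1 / (R - r)) * volume (ball (0 : ℂ) r)) := by
              rw [lintegral_add_right _ (by fun_prop), lintegral_add_right _ (by fun_prop),
                setLIntegral_const]
          _ ≤ ENNReal.ofReal (K * (1 + Real.log (M / ‖g 0‖))) + ENNReal.ofReal C₀ := by
              gcongr
              rw [hC₀, ENNReal.ofReal_add (by positivity) (by positivity), ← hI₀fin,
                ENNReal.ofReal_mul (by positivity), hvolfin]
              refine add_le_add_left (lintegral_enorm_inv_sub_le ?_) _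
              simpa using (hρ'.trans hR).le
          _ ≤ _ := by
              have hgA : 0 ≤ Real.log (M / ‖g 0‖) := Real.log_nonneg
                ((one_le_div hg0').2 (hmax g hg M hgM 0 (mem_closedBall_self hR0.le)))
              rw [← ENNReal.ofReal_add (by positivity) (by positivity)]
              apply ENNReal.ofReal_le_ofReal
              have h2 : C₀ ≤ K * lam := by
                rw [hK, add_mul, div_mul_cancel₀ _ hlam0.ne']
                have : 0 ≤ K₁ * vol * lam := by positivity
                linarith
              nlinarith
      · push Not at hz
        calc ∫⁻ z in ball (0 : ℂ) r, ‖logDeriv f z‖ₑ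
            ≤ ∫⁻ z in ball (0 : ℂ) r, ENNReal.ofReal (K₁ * (1 + Real.log (M / ‖f 0‖))) := by
              refine setLIntegral_mono' measurableSet_ball fun z hz' => ?_
              rw [← ofReal_norm]
              exact ENNReal.ofReal_le_ofReal (norm_logDeriv_le_of_ne_zero hf hr hr₂ hz
                (fun w hw => hMf w (ball_subset_closedBall (ball_subset_ball hR.le hw))) hz')
          _ = ENNReal.ofReal (K₁ * (1 + Real.log (M / ‖f 0‖)) * vol) := by
              rw [setLIntegral_const, hvolfin, ENNReal.ofReal_mul (p := K₁ * _) (by positivity)]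
          _ ≤ _ := by
              apply ENNReal.ofReal_le_ofReal
              rw [hK, mul_right_comm]
              gcongr
              have : 0 ≤ C₀ / lam := by positivity
              linarith
  intro f hf hf0 M hM
  obtain ⟨n, hn⟩ := exists_nat_gt (Real.log (M / ‖f 0‖) / lam)
  exact key n f hf hf0 M hM ((div_lt_iff₀ hlam0).1 hn)

/-! ### Growth of `(s - 1) ζ(s)` for `Re s > 0` and a lower bound for `ζ` on `Re s ≥ 2`. -/

/-- The fractional part, restricted to `(1, ∞)`. -/
noncomputable def fractTail : ℝ → ℂ := (Ioi (1 : ℝ)).indicator fun t => ((Int.fract t : ℝ) : ℂ)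

theorem norm_fractTail_le (t : ℝ) : ‖fractTail t‖ ≤ 1 := by
  unfold fractTail
  by_cases h : t ∈ Ioi (1 : ℝ)
  · rw [indicator_of_mem h, Complex.norm_real, Real.norm_eq_abs, abs_of_nonneg (Int.fract_nonneg _)]
    exact (Int.fract_lt_one t).le
  · rw [indicator_of_notMem h]; simp

theorem measurable_fractTail : Measurable fractTail :=
  Measurable.indicator (by fun_prop) measurableSet_Ioi

theorem differentiableAt_mellin_fractTail {s : ℂ} (hs : s.re < 0) :
    DifferentiableAt ℂ (mellin fractTail) s := by
  refine mellin_differentiableAt_of_isBigO_rpow (a := 0) (b := s.re - 1) ?_ ?_ hs ?_ (by linarith)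
  · refine LocallyIntegrable.locallyIntegrableOn ?_ _
    refine (locallyIntegrable_const (1 : ℝ)).mono measurable_fractTail.aestronglyMeasurable ?_
    exact Eventually.of_forall fun t => by simpa using norm_fractTail_le t
  · refine Asymptotics.IsBigO.of_bound 1 (Eventually.of_forall fun t => ?_)
    simpa using norm_fractTail_le t
  · refine Asymptotics.IsBigO.of_bound 1 ?_
    filter_upwards [Ioo_mem_nhdsGT (show (0 : ℝ) < 1 by norm_num)] with t ht
    have : t ∉ Ioi (1 : ℝ) := by simpa using ht.2.le
    simp only [fractTail, indicator_of_notMem this, norm_zero]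
    positivity

theorem mellin_fractTail_neg (s : ℂ) :
    mellin fractTail (-s) =
      ∫ t in Ioi (1 : ℝ), (t : ℂ) ^ (-(s + 1)) * ((Int.fract t : ℝ) : ℂ) := by
  unfold mellin fractTail
  have h1 : ∀ t : ℝ, (t : ℂ) ^ (-s - 1) •
      (Ioi (1 : ℝ)).indicator (fun t => ((Int.fract t : ℝ) : ℂ)) t =
      (Ioi (1 : ℝ)).indicator (fun t => (t : ℂ) ^ (-(s + 1)) * ((Int.fract t : ℝ) : ℂ)) t := by
    intro t
    by_cases h : t ∈ Ioi (1 : ℝ)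
    · simp only [indicator_of_mem h, smul_eq_mul]
      ring_nf
    · simp only [indicator_of_notMem h, smul_zero]
  simp_rw [h1]
  rw [setIntegral_indicator measurableSet_Ioi]
  congr 2
  exact inter_eq_right.2 (Ioi_subset_Ioi zero_le_one)

theorem norm_mellin_fractTail_neg_le {s : ℂ} (hs : 0 < s.re) :
    ‖mellin fractTail (-s)‖ ≤ 1 / s.re := by
  rw [mellin_fractTail_neg]
  calc _ ≤ ∫ t in Ioi (1 : ℝ), t ^ (-(s.re + 1)) := by
        refine norm_integral_le_of_norm_le
          (integrableOn_Ioi_rpow_of_lt (by linarith) zero_lt_one) ?_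
        filter_upwards [ae_restrict_mem measurableSet_Ioi] with t ht
        have ht0 : 0 < t := zero_lt_one.trans ht
        rw [norm_mul, Complex.norm_cpow_eq_rpow_re_of_pos ht0, Complex.norm_real,
          Real.norm_eq_abs, abs_of_nonneg (Int.fract_nonneg _)]
        simp only [Complex.neg_re, Complex.add_re, Complex.one_re]
        exact mul_le_of_le_one_right (by positivity) (Int.fract_lt_one t).le
    _ = 1 / s.re := by
        rw [integral_Ioi_rpow_of_lt (by linarith) zero_lt_one]
        simp

/-- Partial summation gives `ζ(s) = s ∫_1^∞ ⌊t⌋ t^(-s-1) dt`. Splitting `⌊t⌋ = t - {t}` isolates the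
pole and leaves a Mellin transform that converges for `Re s > 0`. -/
theorem riemannZeta₁_eq_of_one_lt_re {s : ℂ} (hs : 1 < s.re) :
    riemannZeta₁ s = s - s * (s - 1) * mellin fractTail (-s) := by
  have hs1 : s ≠ 1 := by rintro rfl; simp at hs
  have hs1' : s - 1 ≠ 0 := sub_ne_zero.2 hs1
  have h1 : riemannZeta s = s * ∫ t in Ioi (1 : ℝ), ((⌊t⌋₊ : ℕ) : ℂ) * (t : ℂ) ^ (-(s + 1)) := by
    rw [← LSeries_one_eq_riemannZeta hs, LSeries_eq_mul_integral' 1 (r := 1) zero_le_one hs]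
    · simp
    · refine Asymptotics.IsBigO.of_bound 1 (Eventually.of_forall fun n => ?_)
      simp
  have hint : IntegrableOn (fun t : ℝ => (t : ℂ) ^ (-s)) (Ioi 1) :=
    integrableOn_Ioi_cpow_of_lt (by simpa using hs) zero_lt_one
  have hint2 : IntegrableOn
      (fun t : ℝ => (t : ℂ) ^ (-(s + 1)) * ((Int.fract t : ℝ) : ℂ)) (Ioi 1) := by
    have h0 : IntegrableOn (fun t : ℝ => (t : ℂ) ^ (-(s + 1))) (Ioi 1) :=
      integrableOn_Ioi_cpow_of_lt (by simp; linarith) zero_lt_one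
    refine Integrable.mul_bdd (c := 1) h0 (by fun_prop) (Eventually.of_forall fun t => ?_)
    rw [Complex.norm_real, Real.norm_eq_abs, abs_of_nonneg (Int.fract_nonneg _)]
    exact (Int.fract_lt_one t).le
  have h2 : ∫ t in Ioi (1 : ℝ), ((⌊t⌋₊ : ℕ) : ℂ) * (t : ℂ) ^ (-(s + 1)) =
      (∫ t in Ioi (1 : ℝ), (t : ℂ) ^ (-s)) - mellin fractTail (-s) := by
    rw [mellin_fractTail_neg, ← integral_sub hint hint2]
    refine setIntegral_congr_fun measurableSet_Ioi fun t ht => ?_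
    have ht0 : 0 < t := zero_lt_one.trans ht
    have htc : (t : ℂ) ≠ 0 := by exact_mod_cast ht0.ne'
    have e1 : (t : ℂ) ^ (-s) = (t : ℂ) ^ (-(s + 1)) * t := by
      have h0 := Complex.cpow_add (-(s + 1)) 1 htc
      rw [Complex.cpow_one] at h0
      rw [← h0]; ring_nf
    have e2 : ((⌊t⌋₊ : ℕ) : ℂ) = t - ((Int.fract t : ℝ) : ℂ) := by
      have : ((⌊t⌋₊ : ℕ) : ℝ) = t - Int.fract t := by
        rw [natCast_floor_eq_intCast_floor ht0.le]
        linarith [Int.floor_add_fract t]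
      exact_mod_cast congrArg (fun x : ℝ => (x : ℂ)) this
    simp only [e1, e2]; ring
  rw [integral_Ioi_cpow_of_lt (by simpa using hs) zero_lt_one] at h2
  have h3 : riemannZeta₁ s = (s - 1) * riemannZeta s := by
    rw [riemannZeta_eq_inv_sub_mul hs1]; field_simp
  rw [h3, h1, h2]
  have h4 : -s + 1 ≠ 0 := by intro h; apply hs1'; linear_combination -h
  simp only [Complex.ofReal_one, Complex.one_cpow]
  field_simp
  ring

theorem riemannZeta₁_eq_of_re_pos {s : ℂ} (hs : 0 < s.re) :
    riemannZeta₁ s = s - s * (s - 1) * mellin fractTail (-s) := by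
  have hopen : IsOpen {s : ℂ | 0 < s.re} := isOpen_lt continuous_const Complex.continuous_re
  have hpre : IsPreconnected {s : ℂ | 0 < s.re} := (convex_halfSpace_re_gt 0).isPreconnected
  have hd : DifferentiableOn ℂ (fun s => s - s * (s - 1) * mellin fractTail (-s))
      {s : ℂ | 0 < s.re} := by
    intro z hz
    have h1 : DifferentiableAt ℂ (fun s => mellin fractTail (-s)) z :=
      DifferentiableAt.comp z (g := mellin fractTail) (f := fun s => -s)
        (differentiableAt_mellin_fractTail (by simpa using hz)) (by fun_prop)
    have : DifferentiableAt ℂ (fun s => s - s * (s - 1) * mellin fractTail (-s)) z := by fun_prop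
    exact this.differentiableWithinAt
  refine (differentiable_riemannZeta₁.differentiableOn.analyticOnNhd hopen).eqOn_of_preconnected_of_eventuallyEq
    (hd.analyticOnNhd hopen) hpre (z₀ := 2) (by simp) ?_ hs
  have : {s : ℂ | 1 < s.re} ∈ 𝓝 (2 : ℂ) :=
    (isOpen_lt continuous_const Complex.continuous_re).mem_nhds (by simp)
  filter_upwards [this] with z hz using riemannZeta₁_eq_of_one_lt_re hz

theorem norm_riemannZeta₁_le {s : ℂ} (hs : 0 < s.re) :
    ‖riemannZeta₁ s‖ ≤ ‖s‖ + ‖s‖ * ‖s - 1‖ / s.re := by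
  rw [riemannZeta₁_eq_of_re_pos hs]
  refine (norm_sub_le _ _).trans ?_
  rw [norm_mul, norm_mul, ← mul_one_div (‖s‖ * ‖s - 1‖)]
  gcongr
  exact norm_mellin_fractTail_neg_le hs

/-- The inverse `1/ζ` is the Dirichlet series of the Möbius function, dominated by the series of
absolute values at `2`. This supplies the lower bound at disc centres `2 + ia`. -/
theorem exists_le_norm_riemannZeta :
    ∃ c : ℝ, 0 < c ∧ ∀ s : ℂ, 2 ≤ s.re → c ≤ ‖riemannZeta s‖ := by
  have hsum : Summable fun n => ‖LSeries.term 1 (2 : ℂ) n‖ :=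
    (LSeriesSummable_one_iff.2 (by simp)).norm
  set S := ∑' n, ‖LSeries.term 1 (2 : ℂ) n‖ with hS
  refine ⟨1 / (S + 1), by positivity, fun s hs => ?_⟩
  have hs1 : 1 < s.re := by linarith
  have h1 := LSeries_one_mul_Lseries_moebius hs1
  rw [LSeries_one_eq_riemannZeta hs1] at h1
  have hle : ∀ n, ‖LSeries.term (fun n => ((ArithmeticFunction.moebius n : ℤ) : ℂ)) s n‖ ≤
      ‖LSeries.term 1 (2 : ℂ) n‖ := by
    intro n
    refine (LSeries.norm_term_le (g := 1) s ?_).trans (LSeries.norm_term_le_of_re_le_re 1 (by simpa using hs) n)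
    simp only [Pi.one_apply, norm_one]
    simp only [Complex.norm_intCast]
    exact_mod_cast ArithmeticFunction.abs_moebius_le_one
  have h2 : ‖LSeries (fun n => ((ArithmeticFunction.moebius n : ℤ) : ℂ)) s‖ ≤ S := by
    refine (norm_tsum_le_tsum_norm ?_).trans (Summable.tsum_le_tsum hle ?_ hsum)
    · exact Summable.of_nonneg_of_le (fun _ => norm_nonneg _) hle hsum
    · exact Summable.of_nonneg_of_le (fun _ => norm_nonneg _) hle hsum
  have h3 := congrArg norm h1
  rw [norm_mul, norm_one] at h3
  have hS0 : 0 < S + 1 := by positivity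
  rw [div_le_iff₀ hS0, ← h3]
  gcongr
  linarith

/-! ### Area integral of `ζ'/ζ` over discs centred on `Re s = 2`. -/

theorem norm_logDeriv_riemannZeta_le {s : ℂ} (hs : s ≠ 1) :
    ‖logDeriv riemannZeta s‖ ≤ ‖logDeriv riemannZeta₁ s‖ + ‖(s - 1)⁻¹‖ := by
  by_cases hz : riemannZeta s = 0
  · rw [logDeriv_apply, hz, div_zero, norm_zero]; positivity
  have hs1 : s - 1 ≠ 0 := sub_ne_zero.2 hs
  have h1 : riemannZeta₁ s ≠ 0 := by
    intro h; apply hz; rw [riemannZeta_eq_inv_sub_mul hs, h, mul_zero]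
  have : logDeriv riemannZeta s = logDeriv riemannZeta₁ s - (s - 1)⁻¹ := by
    rw [logDeriv_apply, logDeriv_apply, deriv_riemannZeta_eq_neg_inv_sub_sq_mul_add hs,
      riemannZeta_eq_inv_sub_mul hs]
    field_simp
    ring
  rw [this]
  exact norm_sub_le _ _

/-- The integrand is at most `1` outside the unit disc about `a`, so the bound is uniform in `a`. It
handles the pole of `ζ`, wherever it lies relative to the disc. -/
theorem lintegral_enorm_inv_sub_le_add (A : Set ℂ) (a : ℂ) :
    ∫⁻ z : ℂ in A, ‖(z - a)⁻¹‖ₑ ≤ (∫⁻ z : ℂ in ball 0 1, ‖z⁻¹‖ₑ) + volume A := by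
  calc ∫⁻ z : ℂ in A, ‖(z - a)⁻¹‖ₑ
      ≤ ∫⁻ z : ℂ in A, ((ball a 1).indicator (fun z => ‖(z - a)⁻¹‖ₑ) z + 1) := by
        refine lintegral_mono fun z => ?_
        by_cases h : z ∈ ball a 1
        · rw [indicator_of_mem h]; exact le_self_add
        · rw [indicator_of_notMem h, zero_add]
          have h1 : 1 ≤ ‖z - a‖ := by simpa [dist_eq_norm] using h
          rw [← ofReal_norm, norm_inv]
          exact ENNReal.ofReal_le_one.2 (inv_le_one_of_one_le₀ h1)
    _ = (∫⁻ z : ℂ in A, (ball a 1).indicator (fun z => ‖(z - a)⁻¹‖ₑ) z) + volume A := by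
        rw [lintegral_add_right _ (by fun_prop)]; simp
    _ ≤ (∫⁻ z : ℂ, (ball a 1).indicator (fun z => ‖(z - a)⁻¹‖ₑ) z) + volume A := by
        gcongr; exact Measure.restrict_le_self
    _ ≤ _ := by
        rw [lintegral_indicator measurableSet_ball]
        gcongr 1
        simpa using lintegral_enorm_inv_sub_le (c := a) (a := a) (r := 1) (d := 0) (by simp)

theorem exists_lintegral_logDeriv_riemannZeta_le :
    ∃ C : ℝ, 0 ≤ C ∧ ∀ a : ℝ, ∫⁻ z in ball (2 + a * Complex.I) (8 / 5),
      ‖logDeriv riemannZeta z‖ₑ ≤ ENNReal.ofReal (C * Real.log (|a| + 2)) := by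
  -- The outer radius is below `2`, so the disc about `2 + ia` stays in `Re s ≥ 1/5`, where the
  -- growth bound applies. The inner radius `8/5` exceeds `√(5/2)`, so it covers a unit-height piece
  -- of `1/2 < Re s ≤ 2`.
  obtain ⟨K, hK, hKf⟩ := exists_lintegral_logDeriv_le (r := 8 / 5) (r₂ := 17 / 10) (R := 9 / 5)
    (by norm_num) (by norm_num) (by norm_num)
  obtain ⟨c, hc, hcz⟩ := exists_le_norm_riemannZeta
  set J := ((∫⁻ z : ℂ in ball 0 1, ‖z⁻¹‖ₑ) + volume (ball (0 : ℂ) (8 / 5))).toReal with hJ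
  have hJfin : (∫⁻ z : ℂ in ball 0 1, ‖z⁻¹‖ₑ) + volume (ball (0 : ℂ) (8 / 5)) =
      ENNReal.ofReal J := (ENNReal.ofReal_toReal (ENNReal.add_ne_top.2
        ⟨(lintegral_enorm_inv_ball_lt_top 1).ne, measure_ball_lt_top.ne⟩)).symm
  have hJ0 : 0 ≤ J := ENNReal.toReal_nonneg
  have hl2 : 0 < Real.log 2 := Real.log_pos (by norm_num)
  refine ⟨(K * (1 + |Real.log (6 / c)|) + J) / Real.log 2 + K * 6, by positivity, fun a => ?_⟩
  set s₀ : ℂ := 2 + a * Complex.I with hs₀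
  have hs₀re : s₀.re = 2 := by simp [hs₀]
  have hs₀n : ‖s₀‖ ≤ 2 + |a| := by
    refine (norm_add_le _ _).trans ?_
    simp
  set f : ℂ → ℂ := fun z => riemannZeta₁ (s₀ + z) with hf
  have hfd : Differentiable ℂ f := by simp only [hf]; fun_prop
  have hf0c : c ≤ ‖f 0‖ := by
    have h1 : s₀ ≠ 1 := by intro h; rw [h] at hs₀re; norm_num at hs₀re
    have h2 : riemannZeta₁ s₀ = (s₀ - 1) * riemannZeta s₀ := by
      rw [riemannZeta_eq_inv_sub_mul h1]; field_simp [sub_ne_zero.2 h1]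
    have h3 : 1 ≤ ‖s₀ - 1‖ := by
      refine le_trans ?_ (Complex.re_le_norm _)
      simp [hs₀re]; norm_num
    simp only [hf, add_zero, h2, norm_mul]
    nlinarith [hcz s₀ hs₀re.ge, norm_nonneg (riemannZeta s₀)]
  have hf0 : f 0 ≠ 0 := norm_pos_iff.1 (hc.trans_le hf0c)
  have hM : ∀ z ∈ sphere (0 : ℂ) (9 / 5), ‖f z‖ ≤ 6 * (|a| + 5) ^ 2 := by
    intro z hz
    have hz' : ‖z‖ = 9 / 5 := by simpa using hz
    have hre : 1 / 5 ≤ (s₀ + z).re := by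
      have := (abs_le.1 (Complex.abs_re_le_norm z)).1
      rw [Complex.add_re, hs₀re]; linarith
    have hn : ‖s₀ + z‖ ≤ |a| + 4 := (norm_add_le _ _).trans (by linarith)
    have hn1 : ‖s₀ + z - 1‖ ≤ |a| + 5 := (norm_sub_le _ _).trans (by simp; linarith)
    refine (norm_riemannZeta₁_le (by linarith)).trans ?_
    have h5 : ‖s₀ + z‖ * ‖s₀ + z - 1‖ / (s₀ + z).re ≤ (|a| + 4) * (|a| + 5) / (1 / 5) := by
      gcongr
    have := abs_nonneg a
    nlinarith
  have h1 := hKf f hfd hf0 _ hM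
  have hlog : Real.log (6 * (|a| + 5) ^ 2 / ‖f 0‖) ≤
      |Real.log (6 / c)| + 6 * Real.log (|a| + 2) := by
    have ha := abs_nonneg a
    calc Real.log (6 * (|a| + 5) ^ 2 / ‖f 0‖) ≤ Real.log ((6 / c) * ((|a| + 2) ^ 3) ^ 2) := by
          apply Real.log_le_log (by positivity)
          rw [div_mul_eq_mul_div]
          gcongr
          nlinarith [mul_nonneg ha ha, mul_nonneg (mul_nonneg ha ha) ha]
      _ = Real.log (6 / c) + 6 * Real.log (|a| + 2) := by
          rw [Real.log_mul (by positivity) (by positivity), ← pow_mul, Real.log_pow]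
          norm_num
      _ ≤ _ := by gcongr; exact le_abs_self _
  have h2 : ∫⁻ z in ball s₀ (8 / 5), ‖logDeriv riemannZeta₁ z‖ₑ =
      ∫⁻ z in ball (0 : ℂ) (8 / 5), ‖logDeriv f z‖ₑ := by
    have e1 : ∀ z, logDeriv f z = logDeriv riemannZeta₁ (s₀ + z) := by
      intro z
      simp only [hf, logDeriv_apply]
      rw [deriv_comp_const_add]
    simp_rw [e1]
    have := (measurePreserving_add_left volume s₀).setLIntegral_comp_preimage_emb
      (measurableEmbedding_addLeft s₀) (fun z => ‖logDeriv riemannZeta₁ z‖ₑ) (ball s₀ (8 / 5))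
    rw [← this]
    congr 2
    ext z; simp [dist_eq_norm]
  calc ∫⁻ z in ball s₀ (8 / 5), ‖logDeriv riemannZeta z‖ₑ
      ≤ ∫⁻ z in ball s₀ (8 / 5), (‖logDeriv riemannZeta₁ z‖ₑ + ‖(z - 1)⁻¹‖ₑ) := by
        refine lintegral_mono_ae ?_
        have : ∀ᵐ z : ℂ ∂(volume.restrict (ball s₀ (8 / 5))), z ≠ 1 :=
          Measure.ae_ne _ 1
        filter_upwards [this] with z hz
        rw [← ofReal_norm, ← ofReal_norm, ← ofReal_norm,
          ← ENNReal.ofReal_add (by positivity) (by positivity)]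
        exact ENNReal.ofReal_le_ofReal (norm_logDeriv_riemannZeta_le hz)
    _ = (∫⁻ z in ball s₀ (8 / 5), ‖logDeriv riemannZeta₁ z‖ₑ) +
        ∫⁻ z in ball s₀ (8 / 5), ‖(z - 1)⁻¹‖ₑ := lintegral_add_right _ (by fun_prop)
    _ ≤ ENNReal.ofReal (K * (1 + (|Real.log (6 / c)| + 6 * Real.log (|a| + 2)))) +
        ENNReal.ofReal J := by
        rw [h2]
        gcongr
        · exact h1.trans (ENNReal.ofReal_le_ofReal (by gcongr))
        · rw [← hJfin]
          refine (lintegral_enorm_inv_sub_le_add _ 1).trans ?_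
          gcongr 1
          rw [Complex.volume_ball, Complex.volume_ball]
    _ ≤ _ := by
        have hla : Real.log 2 ≤ Real.log (|a| + 2) :=
          Real.log_le_log (by norm_num) (by linarith [abs_nonneg a])
        have hla0 : 0 < Real.log (|a| + 2) := hl2.trans_le hla
        rw [← ENNReal.ofReal_add (by positivity) hJ0]
        apply ENNReal.ofReal_le_ofReal
        have h3 : K * (1 + |Real.log (6 / c)|) + J ≤
            (K * (1 + |Real.log (6 / c)|) + J) / Real.log 2 * Real.log (|a| + 2) := by
          rw [div_mul_eq_mul_div, le_div_iff₀ hl2]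
          gcongr
        nlinarith

/-! ### A majorant of `log ζ` on horizontal lines and its mean over unit intervals. -/

theorem measurable_logDeriv_riemannZeta : Measurable (logDeriv riemannZeta) := by
  have h : Measurable riemannZeta :=
    measurable_of_continuousOn_compl_singleton 1
      differentiableOn_riemannZeta.continuousOn
  exact (measurable_deriv _).div h

/-- A majorant of `logZeta` on the part of a horizontal line in the half plane `Re s ≥ 1 / 2`. -/
noncomputable def zetaMajorant (w : ℝ) : ℝ≥0∞ :=
  ∫⁻ u in Ioi (1 / 2 : ℝ), ‖logDeriv riemannZeta (u + w * Complex.I)‖ₑ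

theorem measurable_zetaMajorant : Measurable zetaMajorant := by
  unfold zetaMajorant
  refine Measurable.lintegral_prod_right'
    (f := fun p : ℝ × ℝ => ‖logDeriv riemannZeta (p.2 + p.1 * Complex.I)‖ₑ) ?_
  exact (measurable_logDeriv_riemannZeta.comp (by fun_prop)).enorm

theorem logZeta_eq (s : ℂ) :
    logZeta s = -∫ α in Ioi s.re, logDeriv riemannZeta (α + s.im * Complex.I) := rfl

/-- One function of the height serves all `σ ≥ 1/2` at once. No zero-freeness is needed: a
non-integrable ray has infinite majorant. -/
theorem enorm_logZeta_le {s : ℂ} (hs : 1 / 2 ≤ s.re) : ‖logZeta s‖ₑ ≤ zetaMajorant s.im := by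
  rw [logZeta_eq, enorm_neg]
  exact (enorm_integral_le_lintegral_enorm _).trans (lintegral_mono_set (Ioi_subset_Ioi hs))

theorem measurable_logZeta_vertical (σ : ℝ) :
    Measurable fun w : ℝ => logZeta (σ + w * Complex.I) := by
  have h : StronglyMeasurable fun w : ℝ =>
      ∫ α in Ioi σ, logDeriv riemannZeta (α + w * Complex.I) := by
    refine StronglyMeasurable.integral_prod_right'
      (f := fun p : ℝ × ℝ => logDeriv riemannZeta (p.2 + p.1 * Complex.I)) ?_
    exact (measurable_logDeriv_riemannZeta.comp (by fun_prop)).stronglyMeasurable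
  have h2 : (fun w : ℝ => logZeta (σ + w * Complex.I)) =
      -fun w : ℝ => ∫ α in Ioi σ, logDeriv riemannZeta (α + w * Complex.I) := by
    ext w
    simp [logZeta_eq]
  rw [h2]
  exact h.measurable.neg

theorem integrableOn_logDeriv_of_zetaMajorant_lt_top {w : ℝ} (hw : zetaMajorant w < ∞) :
    IntegrableOn (fun u : ℝ => logDeriv riemannZeta (u + w * Complex.I)) (Ioi (1 / 2)) :=
  ⟨(measurable_logDeriv_riemannZeta.comp (by fun_prop)).aestronglyMeasurable, hw⟩

theorem tendsto_logZeta_half {w : ℝ} (hw : zetaMajorant w < ∞) {σ : ℕ → ℝ}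
    (hσ : ∀ n, 1 / 2 ≤ σ n) (hlim : Tendsto σ atTop (𝓝 (1 / 2))) :
    Tendsto (fun n => logZeta (σ n + w * Complex.I)) atTop
      (𝓝 (logZeta ((1 / 2 : ℝ) + w * Complex.I))) := by
  have hint := integrableOn_logDeriv_of_zetaMajorant_lt_top hw
  simp only [logZeta_eq, Complex.add_re, Complex.ofReal_re, Complex.mul_re, Complex.I_re, mul_zero,
    Complex.ofReal_im, Complex.I_im, mul_one, sub_self, add_zero, Complex.add_im, Complex.mul_im,
    zero_add]
  refine Tendsto.neg ?_
  have h1 : ∀ c : ℝ, 1 / 2 ≤ c → ∫ α in Ioi c, logDeriv riemannZeta (α + w * Complex.I) =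
      ∫ α in Ioi (1 / 2 : ℝ),
        (Ioi c).indicator (fun α : ℝ => logDeriv riemannZeta (α + w * Complex.I)) α := by
    intro c hc
    rw [setIntegral_indicator measurableSet_Ioi]
    congr 2
    exact (inter_eq_right.2 (Ioi_subset_Ioi hc)).symm
  simp_rw [h1 _ (hσ _)]
  refine tendsto_integral_of_dominated_convergence
    (fun u : ℝ => ‖logDeriv riemannZeta (u + w * Complex.I)‖) ?_ hint.norm ?_ ?_
  · intro n
    exact hint.aestronglyMeasurable.indicator measurableSet_Ioi
  · intro n
    exact Eventually.of_forall fun u => norm_indicator_le_norm_self _ _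
  · filter_upwards [ae_restrict_mem measurableSet_Ioi] with u hu
    refine tendsto_const_nhds.congr' ?_
    filter_upwards [hlim.eventually (gt_mem_nhds hu)] with n hn
    rw [indicator_of_mem (show u ∈ Ioi (σ n) from hn)]

/-- In the Dirichlet series of `ζ'/ζ` only `n ≥ 2` contribute, and `n^(-(Re s - 2)) ≤ 2^(-(Re s -
2))`. The exponential decay makes the integral along the ray converge uniformly in the height. -/
theorem exists_norm_logDeriv_riemannZeta_le_exp :
    ∃ K : ℝ, 0 ≤ K ∧ ∀ s : ℂ, 2 ≤ s.re →
      ‖logDeriv riemannZeta s‖ ≤ K * Real.exp (-Real.log 2 * (s.re - 2)) := by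
  set f : ℕ → ℂ := fun n => ((ArithmeticFunction.vonMangoldt n : ℝ) : ℂ) with hf
  have hsum : Summable fun n => ‖LSeries.term f (2 : ℂ) n‖ :=
    (ArithmeticFunction.LSeriesSummable_vonMangoldt (by simp)).norm
  refine ⟨∑' n, ‖LSeries.term f (2 : ℂ) n‖, tsum_nonneg fun _ => norm_nonneg _, fun s hs => ?_⟩
  have h1 := ArithmeticFunction.LSeries_vonMangoldt_eq_deriv_riemannZeta_div
    (s := s) (by linarith)
  have h2 : ‖logDeriv riemannZeta s‖ = ‖LSeries f s‖ := by
    rw [hf, h1, logDeriv_apply, neg_div, norm_neg]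
  have hle : ∀ n, ‖LSeries.term f s n‖ ≤
      ‖LSeries.term f (2 : ℂ) n‖ * Real.exp (-Real.log 2 * (s.re - 2)) := by
    intro n
    rcases Nat.lt_or_ge n 2 with hn | hn
    · interval_cases n <;> simp [hf]
    · have hn0 : (0 : ℝ) < n := by positivity
      rw [LSeries.norm_term_eq, LSeries.norm_term_eq, if_neg (by omega), if_neg (by omega)]
      have e1 : (n : ℝ) ^ s.re = (n : ℝ) ^ (2 : ℂ).re * (n : ℝ) ^ (s.re - 2) := by
        rw [← Real.rpow_add hn0]; simp
      have e2 : Real.exp (-Real.log 2 * (s.re - 2)) = ((2 : ℝ) ^ (s.re - 2))⁻¹ := by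
        rw [Real.rpow_def_of_pos (by norm_num), ← Real.exp_neg]; ring_nf
      rw [e1, e2, ← div_div, div_eq_mul_inv (_ / _) ((n : ℝ) ^ (s.re - 2))]
      gcongr
      exact_mod_cast hn
  rw [h2, ← tsum_mul_right]
  have hsum' := hsum.mul_right (Real.exp (-Real.log 2 * (s.re - 2)))
  have hsn := Summable.of_nonneg_of_le (fun n => norm_nonneg _) hle hsum'
  exact (norm_tsum_le_tsum_norm hsn).trans (Summable.tsum_le_tsum hle hsn hsum')

/-- Tonelli turns the iterated integral into an area integral over a rectangle whose farthest
corners are at distance `√(5/2) < 8/5` from the centre of the disc. -/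
theorem lintegral_vertical_strip_le (a : ℝ) :
    ∫⁻ w in Ioc a (a + 1), ∫⁻ u in Ioc (1 / 2 : ℝ) 2,
      ‖logDeriv riemannZeta (u + w * Complex.I)‖ₑ ≤
    ∫⁻ z in ball (2 + ((a + 1 / 2 : ℝ) : ℂ) * Complex.I) (8 / 5), ‖logDeriv riemannZeta z‖ₑ := by
  set F : ℝ × ℝ → ℝ≥0∞ := fun p => ‖logDeriv riemannZeta (p.1 + p.2 * Complex.I)‖ₑ with hF
  have hFm : Measurable F := (measurable_logDeriv_riemannZeta.comp (by fun_prop)).enorm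
  have h1 : ∫⁻ w in Ioc a (a + 1), ∫⁻ u in Ioc (1 / 2 : ℝ) 2,
      ‖logDeriv riemannZeta (u + w * Complex.I)‖ₑ =
      ∫⁻ p in Ioc (1 / 2 : ℝ) 2 ×ˢ Ioc a (a + 1), F p := by
    rw [Measure.volume_eq_prod, ← Measure.prod_restrict, lintegral_prod_symm' _ hFm]
  have h2 := Complex.volume_preserving_equiv_real_prod.setLIntegral_comp_preimage_emb
    Complex.measurableEquivRealProd.measurableEmbedding F (Ioc (1 / 2 : ℝ) 2 ×ˢ Ioc a (a + 1))
  rw [h1, ← h2]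
  have h3 : ∀ z : ℂ, F (Complex.measurableEquivRealProd z) = ‖logDeriv riemannZeta z‖ₑ := by
    intro z
    simp [hF, Complex.measurableEquivRealProd_apply, Complex.re_add_im]
  simp_rw [h3]
  refine lintegral_mono_set fun z hz => ?_
  simp only [mem_preimage, Complex.measurableEquivRealProd_apply, mem_prod, mem_Ioc] at hz
  obtain ⟨⟨h4, h5⟩, h6, h7⟩ := hz
  rw [mem_ball, dist_eq_norm, ← sq_lt_sq₀ (norm_nonneg _) (by norm_num), ← Complex.normSq_eq_norm_sq,
    Complex.normSq_apply]
  simp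
  nlinarith

theorem exists_lintegral_zetaMajorant_le :
    ∃ C : ℝ, 0 ≤ C ∧ ∀ a : ℝ,
      ∫⁻ w in Ioc a (a + 1), zetaMajorant w ≤ ENNReal.ofReal (C * Real.log (|a| + 2)) := by
  obtain ⟨C, hC, hCz⟩ := exists_lintegral_logDeriv_riemannZeta_le
  obtain ⟨K, hK, hKz⟩ := exists_norm_logDeriv_riemannZeta_le_exp
  have hl2 : 0 < Real.log 2 := Real.log_pos (by norm_num)
  have hint : IntegrableOn (fun u : ℝ => K * Real.exp (-Real.log 2 * (u - 2))) (Ioi 2) := by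
    have := (integrableOn_exp_mul_Ioi (a := -Real.log 2) (by linarith) 2).const_mul
      (K * Real.exp (Real.log 2 * 2))
    refine this.congr (Eventually.of_forall fun u => ?_)
    simp only
    rw [mul_assoc, ← Real.exp_add]; ring_nf
  set B := (∫⁻ u in Ioi (2 : ℝ), ‖K * Real.exp (-Real.log 2 * (u - 2))‖ₑ).toReal with hB
  have hBfin : ∫⁻ u in Ioi (2 : ℝ), ‖K * Real.exp (-Real.log 2 * (u - 2))‖ₑ = ENNReal.ofReal B :=
    (ENNReal.ofReal_toReal hint.2.ne).symm
  have hB0 : 0 ≤ B := ENNReal.toReal_nonneg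
  have hsplit : ∀ w, zetaMajorant w ≤
      (∫⁻ u in Ioc (1 / 2 : ℝ) 2, ‖logDeriv riemannZeta (u + w * Complex.I)‖ₑ) +
        ENNReal.ofReal B := by
    intro w
    unfold zetaMajorant
    rw [← Ioc_union_Ioi_eq_Ioi (show (1 / 2 : ℝ) ≤ 2 by norm_num)]
    refine (lintegral_union_le _ _ _).trans ?_
    gcongr
    rw [← hBfin]
    refine setLIntegral_mono' measurableSet_Ioi fun u hu => ?_
    rw [← ofReal_norm, ← ofReal_norm]
    refine ENNReal.ofReal_le_ofReal ?_
    have := hKz (u + w * Complex.I) (by simpa using (le_of_lt hu))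
    rw [Real.norm_of_nonneg (by positivity)]
    simpa using this
  refine ⟨C * 2 + B / Real.log 2, by positivity, fun a => ?_⟩
  have ha := abs_nonneg a
  have hla : Real.log 2 ≤ Real.log (|a| + 2) := Real.log_le_log (by norm_num) (by linarith)
  have hla0 : 0 < Real.log (|a| + 2) := hl2.trans_le hla
  have hlog : Real.log (|a + 1 / 2| + 2) ≤ 2 * Real.log (|a| + 2) := by
    have : (2 : ℝ) * Real.log (|a| + 2) = Real.log ((|a| + 2) ^ 2) := by rw [Real.log_pow]; norm_num
    rw [this]
    apply Real.log_le_log (by positivity)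
    have h1 : |a + 1 / 2| ≤ |a| + 1 / 2 := (abs_add_le _ _).trans (by norm_num)
    nlinarith
  calc ∫⁻ w in Ioc a (a + 1), zetaMajorant w
      ≤ ∫⁻ w in Ioc a (a + 1),
        ((∫⁻ u in Ioc (1 / 2 : ℝ) 2, ‖logDeriv riemannZeta (u + w * Complex.I)‖ₑ) +
          ENNReal.ofReal B) := lintegral_mono hsplit
    _ = (∫⁻ w in Ioc a (a + 1),
        ∫⁻ u in Ioc (1 / 2 : ℝ) 2, ‖logDeriv riemannZeta (u + w * Complex.I)‖ₑ) +
          ENNReal.ofReal B := by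
        rw [lintegral_add_right _ (by fun_prop)]; simp
    _ ≤ ENNReal.ofReal (C * (2 * Real.log (|a| + 2))) + ENNReal.ofReal B := by
        gcongr
        refine (lintegral_vertical_strip_le a).trans ((hCz _).trans ?_)
        exact ENNReal.ofReal_le_ofReal (by gcongr)
    _ ≤ _ := by
        rw [← ENNReal.ofReal_add (by positivity) hB0]
        apply ENNReal.ofReal_le_ofReal
        have h3 : B ≤ B / Real.log 2 * Real.log (|a| + 2) := by
          rw [div_mul_eq_mul_div, le_div_iff₀ hl2]
          gcongr
        nlinarith

/-! ### The Dirichlet series of `log ζ` and its holomorphy under RH. -/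

/-- The coefficients `Λ(n) / log n` of the Dirichlet series of `log ζ`. -/
noncomputable def logZetaCoeff (n : ℕ) : ℂ :=
  ((ArithmeticFunction.vonMangoldt n / Real.log n : ℝ) : ℂ)

theorem norm_logZetaCoeff_le (n : ℕ) : ‖logZetaCoeff n‖ ≤ 1 := by
  unfold logZetaCoeff
  rw [Complex.norm_real, Real.norm_of_nonneg (div_nonneg ArithmeticFunction.vonMangoldt_nonneg
    (Real.log_natCast_nonneg n))]
  exact div_le_one_of_le₀ ArithmeticFunction.vonMangoldt_le_log (Real.log_natCast_nonneg n)

theorem abscissa_logZetaCoeff_le : LSeries.abscissaOfAbsConv logZetaCoeff ≤ 1 :=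
  LSeries.abscissaOfAbsConv_le_of_le_const ⟨1, fun n _ => norm_logZetaCoeff_le n⟩

theorem LSeriesSummable_logZetaCoeff {s : ℂ} (hs : 1 < s.re) : LSeriesSummable logZetaCoeff s :=
  LSeriesSummable_of_abscissaOfAbsConv_lt_re
    (abscissa_logZetaCoeff_le.trans_lt (by exact_mod_cast hs))

/-- Term-by-term integration of `-ζ'/ζ = ∑ Λ(n) n^(-s)` along the ray: each `n^(-α)` contributes the
factor `1 / log n`. The integrals of absolute values are the absolute terms of the resulting series,
so the exchange is justified. -/
theorem logZeta_eq_LSeries {s : ℂ} (hs : 1 < s.re) : logZeta s = LSeries logZetaCoeff s := by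
  set f : ℕ → ℂ := fun n => ((ArithmeticFunction.vonMangoldt n : ℝ) : ℂ) with hf
  set F : ℕ → ℝ → ℂ := fun n α => LSeries.term f (α + s.im * Complex.I) n with hF
  have hFexp : ∀ n : ℕ, 2 ≤ n → ∀ α : ℝ, F n α =
      (f n * Complex.exp (-(Real.log n : ℂ) * (s.im * Complex.I))) *
        Complex.exp (-(Real.log n : ℂ) * α) := by
    intro n hn α
    have hn0 : (n : ℂ) ≠ 0 := by exact_mod_cast (by omega : n ≠ 0)
    simp only [hF]
    rw [LSeries.term_of_ne_zero (by omega), div_eq_mul_inv, ← Complex.cpow_neg,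
      Complex.cpow_def_of_ne_zero hn0, ← Complex.natCast_log, mul_assoc, ← Complex.exp_add]
    ring_nf
  have hF0 : ∀ n : ℕ, n < 2 → ∀ α : ℝ, F n α = 0 := by
    intro n hn α
    simp only [hF]
    interval_cases n <;> simp [hf]
  have hlogpos : ∀ n : ℕ, 2 ≤ n → 0 < Real.log n := fun n hn =>
    Real.log_pos (by exact_mod_cast hn)
  have hre : ∀ n : ℕ, 2 ≤ n → (-((Real.log n : ℝ) : ℂ)).re < 0 := fun n hn => by
    rw [Complex.neg_re, Complex.ofReal_re]
    linarith [hlogpos n hn]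
  have hint : ∀ n, Integrable (F n) (volume.restrict (Ioi s.re)) := by
    intro n
    rcases Nat.lt_or_ge n 2 with hn | hn
    · rw [funext (hF0 n hn)]; exact integrable_zero _ _ _
    · rw [funext (hFexp n hn)]
      exact (integrableOn_exp_mul_complex_Ioi (hre n hn) _).const_mul _
  have hval : ∀ n, ∫ α in Ioi s.re, F n α = LSeries.term logZetaCoeff s n := by
    intro n
    rcases Nat.lt_or_ge n 2 with hn | hn
    · simp only [hF0 n hn, integral_zero]
      interval_cases n <;> simp [logZetaCoeff]
    · simp only [hFexp n hn]
      have hn0 : (n : ℂ) ≠ 0 := by exact_mod_cast (by omega : n ≠ 0)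
      rw [integral_const_mul, integral_exp_mul_complex_Ioi (hre n hn),
        LSeries.term_of_ne_zero (by omega), div_eq_mul_inv (logZetaCoeff n), ← Complex.cpow_neg,
        Complex.cpow_def_of_ne_zero hn0, ← Complex.natCast_log]
      have e1 : ((Real.log n : ℝ) : ℂ) * -s = -((Real.log n : ℝ) : ℂ) * (s.im * Complex.I) +
          -((Real.log n : ℝ) : ℂ) * s.re := by
        conv_lhs => rw [← Complex.re_add_im s]
        ring
      rw [e1, Complex.exp_add]
      simp only [logZetaCoeff, hf]
      push_cast
      have : ((Real.log n : ℝ) : ℂ) ≠ 0 := by exact_mod_cast (hlogpos n hn).ne'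
      field_simp
  have hnorm : ∀ n, ∫ α in Ioi s.re, ‖F n α‖ = ‖LSeries.term logZetaCoeff s n‖ := by
    intro n
    rcases Nat.lt_or_ge n 2 with hn | hn
    · simp only [hF0 n hn, norm_zero, integral_zero]
      interval_cases n <;> simp [logZetaCoeff]
    · have hn0 : (0 : ℝ) < n := by positivity
      have e1 : ∀ α : ℝ, ‖F n α‖ = ArithmeticFunction.vonMangoldt n *
          Real.exp (-Real.log n * α) := by
        intro α
        rw [hFexp n hn, norm_mul, norm_mul, Complex.norm_exp, Complex.norm_exp]
        simp [-Complex.natCast_log, hf,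
          abs_of_nonneg ArithmeticFunction.vonMangoldt_nonneg]
      simp only [e1]
      rw [integral_const_mul, integral_exp_mul_Ioi (by simpa using hlogpos n hn),
        LSeries.norm_term_eq, if_neg (by omega)]
      simp only [logZetaCoeff]
      rw [Complex.norm_real, Real.norm_of_nonneg (div_nonneg ArithmeticFunction.vonMangoldt_nonneg
        (hlogpos n hn).le), div_eq_mul_inv (_ / _), ← Real.rpow_neg hn0.le,
        Real.rpow_def_of_pos hn0]
      have : Real.log n ≠ 0 := (hlogpos n hn).ne'
      field_simp
  have hsum : Summable fun n => ∫ α in Ioi s.re, ‖F n α‖ := by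
    simp_rw [hnorm]
    exact (LSeriesSummable_logZetaCoeff hs).norm
  have h1 := integral_tsum_of_summable_integral_norm hint hsum
  simp_rw [hval] at h1
  rw [logZeta_eq, LSeries, h1, ← integral_neg]
  refine setIntegral_congr_fun measurableSet_Ioi fun α hα => ?_
  have := ArithmeticFunction.LSeries_vonMangoldt_eq_deriv_riemannZeta_div
    (s := α + s.im * Complex.I) (by simpa using hs.trans hα)
  simp only [LSeries] at this
  simp only [hF, hf, this, logDeriv_apply, neg_div]

theorem riemannZeta_ne_zero_of_half_lt (hRH : RiemannHypothesis) {s : ℂ} (hs : 1 / 2 < s.re)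
    (hs1 : s ≠ 1) : riemannZeta s ≠ 0 := by
  intro h
  have := hRH s h (by
    rintro ⟨n, rfl⟩
    have : (-2 * ((n : ℂ) + 1)).re = -2 * (n + 1) := by simp
    rw [this] at hs
    have : (0 : ℝ) ≤ n := n.cast_nonneg
    linarith) hs1
  linarith

theorem differentiableOn_logDeriv_riemannZeta (hRH : RiemannHypothesis) :
    DifferentiableOn ℂ (logDeriv riemannZeta) {s : ℂ | 1 / 2 < s.re ∧ s.im ≠ 0} := by
  have hne : ∀ s ∈ {s : ℂ | 1 / 2 < s.re ∧ s.im ≠ 0}, s ≠ 1 := by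
    rintro s ⟨-, h⟩ rfl; simp at h
  have hopen : IsOpen ({1}ᶜ : Set ℂ) := isOpen_compl_singleton
  have h1 : DifferentiableOn ℂ (deriv riemannZeta) {1}ᶜ := differentiableOn_riemannZeta.deriv hopen
  exact (h1.mono hne).div (differentiableOn_riemannZeta.mono hne)
    fun s hs => riemannZeta_ne_zero_of_half_lt hRH hs.1 (hne s hs)

theorem isOpen_half_im_ne_zero : IsOpen {s : ℂ | 1 / 2 < s.re ∧ s.im ≠ 0} :=
  (isOpen_lt continuous_const Complex.continuous_re).inter
    (isOpen_ne_fun Complex.continuous_im continuous_const)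

theorem differentiableAt_logZeta_of_one_lt_re {s : ℂ} (hs : 1 < s.re) :
    DifferentiableAt ℂ logZeta s := by
  have h1 : DifferentiableAt ℂ (LSeries logZetaCoeff) s :=
    (LSeries_hasDerivAt (abscissa_logZetaCoeff_le.trans_lt (by exact_mod_cast hs))).differentiableAt
  refine h1.congr_of_eventuallyEq ?_
  filter_upwards [(isOpen_lt continuous_const Complex.continuous_re).mem_nhds hs] with z hz
  exact logZeta_eq_LSeries hz

theorem integrableOn_logDeriv_Ioi (hRH : RiemannHypothesis) {s : ℂ} (hs : 1 / 2 < s.re)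
    (hs0 : s.im ≠ 0) :
    IntegrableOn (fun α : ℝ => logDeriv riemannZeta (α + s.im * Complex.I)) (Ioi s.re) := by
  obtain ⟨K, hK, hKz⟩ := exists_norm_logDeriv_riemannZeta_le_exp
  have hcont : ContinuousOn (fun α : ℝ => logDeriv riemannZeta (α + s.im * Complex.I))
      (Icc s.re (s.re + 2)) := by
    refine (differentiableOn_logDeriv_riemannZeta hRH).continuousOn.comp (by fun_prop) ?_
    intro α hα
    refine ⟨?_, by simpa using hs0⟩
    simpa using hs.trans_le hα.1
  have h1 : IntegrableOn (fun α : ℝ => logDeriv riemannZeta (α + s.im * Complex.I))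
      (Ioc s.re (s.re + 2)) := hcont.integrableOn_Icc.mono_set Ioc_subset_Icc_self
  rw [← Ioc_union_Ioi_eq_Ioi (show s.re ≤ s.re + 2 by linarith)]
  refine h1.union ?_
  have hint : IntegrableOn (fun u : ℝ => K * Real.exp (-Real.log 2 * (u - 2)))
      (Ioi (s.re + 2)) := by
    have := (integrableOn_exp_mul_Ioi (a := -Real.log 2)
      (neg_lt_zero.2 (Real.log_pos (by norm_num))) (s.re + 2)).const_mul
      (K * Real.exp (Real.log 2 * 2))
    refine this.congr (Eventually.of_forall fun u => ?_)
    simp only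
    rw [mul_assoc, ← Real.exp_add]; ring_nf
  refine Integrable.mono' hint
    (measurable_logDeriv_riemannZeta.comp (by fun_prop)).aestronglyMeasurable ?_
  filter_upwards [ae_restrict_mem measurableSet_Ioi] with u hu
  have hu' : s.re + 2 < u := hu
  simpa using hKz (u + s.im * Complex.I) (by simp; linarith)

/-- Moves the infinite end of the ray into `Re s > 1`, where the Dirichlet series already gives
holomorphy. Only an integral over a compact interval is left to differentiate in `s`. -/
theorem logZeta_eq_add_two (hRH : RiemannHypothesis) {s : ℂ} (hs : 1 / 2 < s.re)
    (hs0 : s.im ≠ 0) :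
    logZeta s = logZeta (s + 2) - ∫ x in (0 : ℝ)..2, logDeriv riemannZeta (s + x) := by
  have hint := integrableOn_logDeriv_Ioi hRH hs hs0
  have h1 : ∫ x in (0 : ℝ)..2, logDeriv riemannZeta (s + x) =
      ∫ α in Ioc s.re (s.re + 2), logDeriv riemannZeta (α + s.im * Complex.I) := by
    rw [← intervalIntegral.integral_of_le (by linarith)]
    have := intervalIntegral.integral_comp_add_left (a := 0) (b := 2)
      (fun α : ℝ => logDeriv riemannZeta (α + s.im * Complex.I)) s.re
    rw [add_zero] at this
    rw [← this]
    congr 1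
    ext x
    congr 1
    conv_lhs => rw [← Complex.re_add_im s]
    push_cast
    ring
  rw [logZeta_eq, logZeta_eq, h1]
  have e1 : (s + 2).re = s.re + 2 := by simp
  have e2 : (s + 2).im = s.im := by simp
  rw [e1, e2, ← Ioc_union_Ioi_eq_Ioi (show s.re ≤ s.re + 2 by linarith),
    setIntegral_union (Ioc_disjoint_Ioi le_rfl) measurableSet_Ioi
      (hint.mono_set Ioc_subset_Ioi_self) (hint.mono_set (Ioi_subset_Ioi (by linarith)))]
  ring

theorem differentiableAt_logZeta (hRH : RiemannHypothesis) {s : ℂ} (hs : 1 / 2 < s.re)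
    (hs0 : s.im ≠ 0) : DifferentiableAt ℂ logZeta s := by
  set U : Set ℂ := {s : ℂ | 1 / 2 < s.re ∧ s.im ≠ 0} with hU
  have hUo : IsOpen U := isOpen_half_im_ne_zero
  have hfd : DifferentiableOn ℂ (logDeriv riemannZeta) U :=
    differentiableOn_logDeriv_riemannZeta hRH
  have hUadd : ∀ z ∈ U, ∀ x : ℝ, 0 ≤ x → z + x ∈ U := by
    rintro z ⟨h1, h2⟩ x hx
    exact ⟨by simp; linarith [h1], by simpa using h2⟩
  obtain ⟨δ, hδ, hδU⟩ := nhds_basis_closedBall.mem_iff.1 (hUo.mem_nhds (show s ∈ U from ⟨hs, hs0⟩))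
  have hd1 : DifferentiableAt ℂ (fun z => logZeta (z + 2)) s :=
    DifferentiableAt.comp s (g := logZeta) (f := fun z => z + 2)
      (differentiableAt_logZeta_of_one_lt_re (by simp; linarith)) (by fun_prop)
  have hcd : ContinuousOn (deriv (logDeriv riemannZeta)) U := (hfd.deriv hUo).continuousOn
  have hcompact : IsCompact (closedBall s δ ×ˢ Icc (0 : ℝ) 2) :=
    (isCompact_closedBall s δ).prod isCompact_Icc
  have hcont2 : ContinuousOn (fun p : ℂ × ℝ => deriv (logDeriv riemannZeta) (p.1 + p.2))
      (closedBall s δ ×ˢ Icc (0 : ℝ) 2) := by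
    refine hcd.comp (by fun_prop) ?_
    rintro ⟨z, x⟩ ⟨hz, hx⟩
    exact hUadd z (hδU hz) x hx.1
  obtain ⟨B, hB⟩ := hcompact.exists_bound_of_continuousOn hcont2
  have hcontx : ∀ z ∈ U, ContinuousOn (fun x : ℝ => logDeriv riemannZeta (z + x)) (Icc 0 2) := by
    intro z hz
    exact hfd.continuousOn.comp (by fun_prop) fun x hx => hUadd z hz x hx.1
  have hui : uIoc (0 : ℝ) 2 ⊆ Icc 0 2 := by
    rw [uIoc_of_le (by norm_num)]; exact Ioc_subset_Icc_self
  have hd2 := (intervalIntegral.hasDerivAt_integral_of_dominated_loc_of_deriv_le (𝕜 := ℂ)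
    (μ := volume) (a := 0) (b := 2) (x₀ := s) (s := closedBall s δ)
    (F := fun z x => logDeriv riemannZeta (z + x))
    (F' := fun z x => deriv (logDeriv riemannZeta) (z + x)) (bound := fun _ => B)
    (closedBall_mem_nhds s hδ)
    (Eventually.of_forall fun z =>
      (measurable_logDeriv_riemannZeta.comp (by fun_prop)).aestronglyMeasurable)
    ((hcontx s ⟨hs, hs0⟩).intervalIntegrable_of_Icc (by norm_num))
    (((measurable_deriv _).comp (by fun_prop)).aestronglyMeasurable)
    (Eventually.of_forall fun x hx z hz => hB (z, x) ⟨hz, hui hx⟩)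
    (by simp)
    (Eventually.of_forall fun x hx z hz => by
      have := (hfd.differentiableAt (hUo.mem_nhds
        (hUadd z (hδU hz) x (hui hx).1))).hasDerivAt
      exact this.comp_add_const z x)).2.differentiableAt
  refine (hd1.sub hd2).congr_of_eventuallyEq ?_
  filter_upwards [hUo.mem_nhds (show s ∈ U from ⟨hs, hs0⟩)] with z hz
  exact logZeta_eq_add_two hRH hz.1 hz.2

/-! ### The transform of a weight: holomorphy and inversion. -/

theorem weightFT_div_I (v : ℝ → ℝ) (z : ℂ) :
    weightFT v (z / Complex.I) = ∫ x : ℝ, Complex.exp (x * z) * (v x : ℂ) := by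
  unfold weightFT
  congr 1
  ext x
  congr 2
  field_simp

theorem weightFT_ofReal_eq (v : ℝ → ℝ) (y : ℝ) :
    weightFT v y = weightFT v (((0 : ℝ) + y * Complex.I) / Complex.I) := by
  congr 1
  simp

/-- As the weight is real, decay for `Im z → ∞` transfers to `Im z → -∞`. -/
theorem weightFT_conj (v : ℝ → ℝ) (z : ℂ) :
    weightFT v ((starRingEnd ℂ) z / Complex.I) = (starRingEnd ℂ) (weightFT v (z / Complex.I)) := by
  rw [weightFT_div_I, weightFT_div_I, ← integral_conj]
  congr 1
  ext x
  simp [← Complex.exp_conj]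

section Weight

variable {v : ℝ → ℝ}

theorem integrable_exp_mul_weight
    (hint : ∀ c : ℝ, 0 ≤ c → Integrable (fun x : ℝ => Real.exp (c * x) * v x)) {z : ℂ}
    (hz : 0 ≤ z.re) (hv : Continuous v) :
    Integrable (fun x : ℝ => Complex.exp (x * z) * (v x : ℂ)) := by
  refine (hint z.re hz).mono (by fun_prop) (Eventually.of_forall fun x => ?_)
  simp [Complex.norm_exp, mul_comm]

theorem continuousOn_weightFT (hv : Continuous v)
    (hint : ∀ c : ℝ, 0 ≤ c → Integrable (fun x : ℝ => Real.exp (c * x) * v x)) :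
    ContinuousOn (fun z : ℂ => weightFT v (z / Complex.I)) {z : ℂ | 0 ≤ z.re} := by
  simp_rw [weightFT_div_I]
  intro z₀ hz₀
  have h0 : Integrable (fun x : ℝ => ‖v x‖) := by simpa using (hint 0 le_rfl).norm
  have h1 := (hint (z₀.re + 1) (by have : 0 ≤ z₀.re := hz₀; linarith)).norm
  refine continuousWithinAt_of_dominated (bound := fun x => ‖v x‖ +
      ‖Real.exp ((z₀.re + 1) * x) * v x‖) (Eventually.of_forall fun z => by fun_prop) ?_
      (h0.add h1) (Eventually.of_forall fun x => by fun_prop)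
  have hnear : {z : ℂ | z.re < z₀.re + 1} ∈ 𝓝 z₀ :=
    (isOpen_lt Complex.continuous_re continuous_const).mem_nhds (by simp)
  filter_upwards [self_mem_nhdsWithin, mem_nhdsWithin_of_mem_nhds hnear] with z hz hz'
  refine Eventually.of_forall fun x => ?_
  have hz : 0 ≤ z.re := hz
  have hz' : z.re < z₀.re + 1 := hz'
  rw [norm_mul, norm_mul, Complex.norm_exp, Complex.norm_real, Real.norm_eq_abs (Real.exp _),
    Real.abs_exp]
  have e : ((x : ℂ) * z).re = x * z.re := by simp
  rw [e]
  have hb : Real.exp (x * z.re) ≤ 1 + Real.exp ((z₀.re + 1) * x) := by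
    rcases le_total 0 x with hx | hx
    · have : Real.exp (x * z.re) ≤ Real.exp ((z₀.re + 1) * x) :=
        Real.exp_le_exp.2 (by nlinarith)
      linarith
    · have : Real.exp (x * z.re) ≤ 1 := Real.exp_le_one_iff.2 (by nlinarith)
      linarith [Real.exp_pos ((z₀.re + 1) * x)]
  nlinarith [norm_nonneg (v x)]

/-- Differentiation brings down a factor `x`. For `x > 0` it is absorbed by a larger exponential
moment, for `x < 0` by the decay of `exp (x Re z)`. The latter costs `2 / Re z₀`, which is why the
boundary line is excluded. -/
theorem differentiableAt_weightFT (hv : Continuous v)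
    (hint : ∀ c : ℝ, 0 ≤ c → Integrable (fun x : ℝ => Real.exp (c * x) * v x)) {z₀ : ℂ}
    (hz₀ : 0 < z₀.re) : DifferentiableAt ℂ (fun z : ℂ => weightFT v (z / Complex.I)) z₀ := by
  simp_rw [weightFT_div_I]
  set a := z₀.re with ha
  have h0 : Integrable (fun x : ℝ => ‖v x‖) := by simpa using (hint 0 le_rfl).norm
  have h1 := (hint (3 / 2 * a + 1) (by positivity)).norm
  refine (hasDerivAt_integral_of_dominated_loc_of_deriv_le (𝕜 := ℂ) (μ := volume)
    (F := fun z (x : ℝ) => Complex.exp (x * z) * (v x : ℂ))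
    (F' := fun z (x : ℝ) => Complex.exp (x * z) * x * (v x : ℂ))
    (s := ball z₀ (a / 2)) (x₀ := z₀)
    (bound := fun x => 2 / a * ‖v x‖ + ‖Real.exp ((3 / 2 * a + 1) * x) * v x‖)
    (ball_mem_nhds z₀ (by positivity)) (Eventually.of_forall fun z => by fun_prop)
    (integrable_exp_mul_weight hint hz₀.le hv) (by fun_prop) ?_ ((h0.const_mul _).add h1)
    (Eventually.of_forall fun x z _ => ?_)).2.differentiableAt
  · refine Eventually.of_forall fun x z hz => ?_
    have hre : |z.re - a| < a / 2 := by
      rw [mem_ball, dist_eq_norm] at hz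
      exact (Complex.abs_re_le_norm (z - z₀)).trans_lt hz
    rw [abs_lt] at hre
    rw [norm_mul, norm_mul, norm_mul, Complex.norm_exp, Complex.norm_real, Complex.norm_real,
      Real.norm_eq_abs (Real.exp _), Real.abs_exp]
    have e : ((x : ℂ) * z).re = x * z.re := by simp
    rw [e, ← add_mul]
    refine mul_le_mul_of_nonneg_right ?_ (norm_nonneg _)
    rcases le_total 0 x with hx | hx
    · rw [Real.norm_of_nonneg hx]
      calc Real.exp (x * z.re) * x ≤ Real.exp (3 / 2 * a * x) * Real.exp x := by
            refine mul_le_mul (Real.exp_le_exp.2 (by nlinarith)) ?_ hx (Real.exp_pos _).le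
            linarith [Real.add_one_le_exp x]
        _ = Real.exp ((3 / 2 * a + 1) * x) := by rw [← Real.exp_add]; ring_nf
        _ ≤ _ := by linarith [show 0 ≤ 2 / a by positivity]
    · rw [Real.norm_of_nonpos hx]
      have h2 : Real.exp (x * z.re) ≤ Real.exp (-(-x * (a / 2))) := Real.exp_le_exp.2 (by nlinarith)
      have h3 : -x * (a / 2) ≤ Real.exp (-x * (a / 2)) := by
        linarith [Real.add_one_le_exp (-x * (a / 2))]
      have h4 : Real.exp (-(-x * (a / 2))) * (-x * (a / 2)) ≤ 1 := by
        rw [Real.exp_neg]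
        exact inv_mul_le_one_of_le₀ h3 (Real.exp_pos _).le
      have h5 : Real.exp (-(-x * (a / 2))) * (-x) ≤ 2 / a := by
        rw [le_div_iff₀ hz₀]; linarith
      calc Real.exp (x * z.re) * -x ≤ Real.exp (-(-x * (a / 2))) * (-x) :=
            mul_le_mul_of_nonneg_right h2 (by linarith)
        _ ≤ _ := by linarith [Real.exp_pos ((3 / 2 * a + 1) * x)]
  · have h2 : HasDerivAt (fun z : ℂ => (x : ℂ) * z) x z := by
      simpa using (hasDerivAt_id z).const_mul (x : ℂ)
    exact h2.cexp.mul_const _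

/-- Fourier inversion on the line `Re z = c`. -/
theorem weight_eq_integral (hv : Continuous v)
    (hint : ∀ c : ℝ, 0 ≤ c → Integrable (fun x : ℝ => Real.exp (c * x) * v x)) {c : ℝ}
    (hc : 0 ≤ c)
    (hW : Integrable fun y : ℝ => weightFT v ((c + y * Complex.I) / Complex.I)) (x : ℝ) :
    (v x : ℂ) = 1 / (2 * (Real.pi : ℂ)) *
      ∫ y : ℝ, Complex.exp (-x * (c + y * Complex.I)) *
        weightFT v ((c + y * Complex.I) / Complex.I) := by
  -- The transform on `Re z = c` is the ordinary Fourier transform of the tilted weight; the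
  -- normalisation `exp (-2πi x w)` corresponds to `y = -2π w`.
  set f : ℝ → ℂ := fun x => ((Real.exp (c * x) * v x : ℝ) : ℂ) with hf
  have hfc : Continuous f := by simp only [hf]; fun_prop
  have hfi : Integrable f := (hint c hc).ofReal
  have hpi : (Real.pi : ℂ) ≠ 0 := by exact_mod_cast Real.pi_ne_zero
  have hFT : ∀ w : ℝ, FourierTransform.fourier f w =
      weightFT v ((c + ((-(2 * Real.pi) * w : ℝ) : ℂ) * Complex.I) / Complex.I) := by
    intro w
    rw [Real.fourier_real_eq_integral_exp_smul, weightFT_div_I]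
    congr 1
    ext y
    simp only [hf, smul_eq_mul]
    push_cast
    rw [← mul_assoc, ← Complex.exp_add]
    ring_nf
  have h2pi : (-(2 * Real.pi)) ≠ 0 := by have := Real.pi_pos; linarith
  have hFi : Integrable (FourierTransform.fourier f) := by
    have := hW.comp_mul_left' h2pi
    refine this.congr (Eventually.of_forall fun w => ?_)
    simp only [hFT]
  have h1 := congrFun (hfc.fourierInv_fourier_eq hfi hFi) x
  rw [Real.fourierInv_eq_fourier_neg, Real.fourier_real_eq_integral_exp_smul] at h1
  have h2 := Measure.integral_comp_mul_left (fun y : ℝ => Complex.exp (-x * (y * Complex.I)) *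
    weightFT v ((c + y * Complex.I) / Complex.I)) (-(2 * Real.pi))
  have h3 : ∫ w : ℝ, Complex.exp (↑(-2 * Real.pi * w * -x) * Complex.I) •
      FourierTransform.fourier f w = |(-(2 * Real.pi))⁻¹| • ∫ y : ℝ,
        Complex.exp (-x * (y * Complex.I)) * weightFT v ((c + y * Complex.I) / Complex.I) := by
    rw [← h2]
    congr 1
    ext w
    rw [hFT, smul_eq_mul]
    congr 2
    push_cast
    ring
  rw [h3] at h1
  have h4 : ∀ y : ℝ, Complex.exp (-x * (c + y * Complex.I)) *
      weightFT v ((c + y * Complex.I) / Complex.I) =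
      Complex.exp (-x * c) * (Complex.exp (-x * (y * Complex.I)) *
        weightFT v ((c + y * Complex.I) / Complex.I)) := by
    intro y
    rw [← mul_assoc, ← Complex.exp_add]; ring_nf
  simp_rw [h4]
  rw [integral_const_mul]
  have h5 : |(-(2 * Real.pi))⁻¹| = 1 / (2 * Real.pi) := by
    rw [inv_neg, abs_neg, abs_of_pos (by have := Real.pi_pos; positivity), one_div]
  rw [h5, Complex.real_smul] at h1
  push_cast at h1
  rw [mul_left_comm, h1]
  simp only [hf]
  push_cast
  rw [← mul_assoc, ← Complex.exp_add]
  ring_nf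
  simp

end Weight

/-! ### Weighted means of the majorant and choice of good heights. -/

theorem summable_log_div_sq :
    Summable fun k : ℤ => 3 / (1 + (k : ℝ) ^ 2) * (1 + Real.log (|(k : ℝ)| + 2) / Real.log 2) := by
  have hl2 : 0 < Real.log 2 := Real.log_pos (by norm_num)
  have hs := (Real.summable_abs_int_rpow (b := 3 / 2) (by norm_num)).mul_left
    (3 * (1 + 4 / Real.log 2))
  refine Summable.of_norm_bounded_eventually hs ?_
  have : ∀ᶠ k : ℤ in cofinite, k ≠ 0 := by
    rw [Filter.eventually_cofinite]
    exact (finite_singleton (0 : ℤ)).subset fun k hk => by simpa using hk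
  filter_upwards [this] with k hk
  have hk1 : (1 : ℝ) ≤ |(k : ℝ)| := by exact_mod_cast Int.one_le_abs hk
  set x := |(k : ℝ)| with hx
  have hx0 : 0 < x := by linarith
  have hsq : (k : ℝ) ^ 2 = x ^ 2 := (sq_abs _).symm
  have hlog0 : 0 ≤ Real.log (x + 2) := Real.log_nonneg (by linarith)
  rw [Real.norm_of_nonneg (by positivity), hsq]
  have hlog : Real.log (x + 2) ≤ 4 * x ^ (1 / 2 : ℝ) := by
    have h1 := Real.log_le_rpow_div (show 0 ≤ x + 2 by linarith) (show (0 : ℝ) < 1 / 2 by norm_num)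
    have h2 : (x + 2) ^ (1 / 2 : ℝ) ≤ (4 * x) ^ (1 / 2 : ℝ) :=
      Real.rpow_le_rpow (by linarith) (by linarith) (by norm_num)
    have h3 : (4 * x) ^ (1 / 2 : ℝ) = 2 * x ^ (1 / 2 : ℝ) := by
      rw [Real.mul_rpow (by norm_num) hx0.le, show (4 : ℝ) = 2 ^ (2 : ℝ) by norm_num,
        ← Real.rpow_mul (by norm_num)]
      norm_num
    rw [div_eq_mul_inv] at h1
    norm_num at h1
    rw [h3] at h2
    norm_num at h2 ⊢
    linarith
  have hx12 : 1 ≤ x ^ (1 / 2 : ℝ) := Real.one_le_rpow hk1 (by norm_num)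
  have h4 : 1 + Real.log (x + 2) / Real.log 2 ≤ (1 + 4 / Real.log 2) * x ^ (1 / 2 : ℝ) := by
    have : Real.log (x + 2) / Real.log 2 ≤ 4 / Real.log 2 * x ^ (1 / 2 : ℝ) := by
      rw [div_mul_eq_mul_div]; gcongr
    linarith
  have h5 : 3 / (1 + x ^ 2) ≤ 3 * x ^ (-2 : ℝ) := by
    rw [Real.rpow_neg hx0.le, Real.rpow_two, ← div_eq_mul_inv]
    gcongr
    linarith
  calc 3 / (1 + x ^ 2) * (1 + Real.log (x + 2) / Real.log 2)
      ≤ (3 * x ^ (-2 : ℝ)) * ((1 + 4 / Real.log 2) * x ^ (1 / 2 : ℝ)) := by gcongr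
    _ = 3 * (1 + 4 / Real.log 2) * (x ^ (-2 : ℝ) * x ^ (1 / 2 : ℝ)) := by ring
    _ = _ := by rw [← Real.rpow_add hx0]; norm_num

/-- Cutting into unit intervals, `log (|t + k| + 2) ≤ log (|t| + 2) + log (|k| + 2)` lets the factor
`log (|t| + 2)` come out of a convergent sum over `k`. -/
theorem exists_lintegral_zetaMajorant_weighted_le :
    ∃ C : ℝ, 0 ≤ C ∧ ∀ t : ℝ,
      ∫⁻ y : ℝ, zetaMajorant (t + y) * ENNReal.ofReal (1 / (1 + y ^ 2)) ≤
        ENNReal.ofReal (C * Real.log (|t| + 2)) := by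
  obtain ⟨C, hC, hCz⟩ := exists_lintegral_zetaMajorant_le
  have hl2 : 0 < Real.log 2 := Real.log_pos (by norm_num)
  set g : ℤ → ℝ := fun k => 3 / (1 + (k : ℝ) ^ 2) * (1 + Real.log (|(k : ℝ)| + 2) / Real.log 2)
    with hg
  have hg0 : ∀ k, 0 ≤ g k := by
    intro k
    have : 0 ≤ Real.log (|(k : ℝ)| + 2) := Real.log_nonneg (by linarith [abs_nonneg (k : ℝ)])
    simp only [hg]; positivity
  have hsum : Summable g := summable_log_div_sq
  refine ⟨C * ∑' k, g k, mul_nonneg hC (tsum_nonneg hg0), fun t => ?_⟩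
  have hlt : Real.log 2 ≤ Real.log (|t| + 2) :=
    Real.log_le_log (by norm_num) (by linarith [abs_nonneg t])
  have hlt0 : 0 < Real.log (|t| + 2) := hl2.trans_le hlt
  have hpiece : ∀ k : ℤ, ∫⁻ y in Ioc (k : ℝ) (k + 1),
      zetaMajorant (t + y) * ENNReal.ofReal (1 / (1 + y ^ 2)) ≤
      ENNReal.ofReal (C * Real.log (|t| + 2) * g k) := by
    intro k
    have hk2 : 0 ≤ Real.log (|(k : ℝ)| + 2) := Real.log_nonneg (by linarith [abs_nonneg (k : ℝ)])
    have hmp : ∫⁻ y in Ioc (k : ℝ) (k + 1), zetaMajorant (t + y) =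
        ∫⁻ w in Ioc (t + k) (t + k + 1), zetaMajorant w := by
      have := (measurePreserving_add_left volume t).setLIntegral_comp_preimage
        (s := Ioc (t + k) (t + k + 1)) measurableSet_Ioc measurable_zetaMajorant
      rw [← this]
      congr 2
      ext y
      simp only [mem_Ioc, mem_preimage]
      constructor <;> rintro ⟨h1, h2⟩ <;> constructor <;> linarith
    calc ∫⁻ y in Ioc (k : ℝ) (k + 1), zetaMajorant (t + y) * ENNReal.ofReal (1 / (1 + y ^ 2))
        ≤ ∫⁻ y in Ioc (k : ℝ) (k + 1),
          zetaMajorant (t + y) * ENNReal.ofReal (3 / (1 + (k : ℝ) ^ 2)) := by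
          refine setLIntegral_mono' measurableSet_Ioc fun y hy => ?_
          gcongr 1
          refine ENNReal.ofReal_le_ofReal ?_
          rw [div_le_div_iff₀ (by positivity) (by positivity)]
          have h1 : (y - k) ^ 2 ≤ 1 := by
            rw [sq_le_one_iff₀ (by linarith [hy.1])]; linarith [hy.2]
          -- From `(y - k)² ≤ 1` and `(2y - k)² ≥ 0` follows `k² ≤ 2y² + 2`, whence the constant
          -- `3`.
          nlinarith [sq_nonneg (2 * y - k)]
      _ = (∫⁻ w in Ioc (t + k) (t + k + 1), zetaMajorant w) *
          ENNReal.ofReal (3 / (1 + (k : ℝ) ^ 2)) := by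
          rw [lintegral_mul_const _ (f := fun y => zetaMajorant (t + y))
            (measurable_zetaMajorant.comp (by fun_prop)), hmp]
      _ ≤ ENNReal.ofReal (C * Real.log (|t + k| + 2)) * ENNReal.ofReal (3 / (1 + (k : ℝ) ^ 2)) := by
          gcongr 1
          exact hCz _
      _ ≤ _ := by
          rw [← ENNReal.ofReal_mul' (by positivity)]
          apply ENNReal.ofReal_le_ofReal
          have h1 : Real.log (|t + k| + 2) ≤ Real.log (|t| + 2) + Real.log (|(k : ℝ)| + 2) := by
            rw [← Real.log_mul (by positivity) (by positivity)]
            apply Real.log_le_log (by positivity)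
            nlinarith [abs_add_le t k, abs_nonneg t, abs_nonneg (k : ℝ),
              mul_nonneg (abs_nonneg t) (abs_nonneg (k : ℝ))]
          have h2 : Real.log (|(k : ℝ)| + 2) ≤
              Real.log (|t| + 2) * (Real.log (|(k : ℝ)| + 2) / Real.log 2) := by
            rw [← mul_div_assoc, le_div_iff₀ hl2, mul_comm]
            gcongr
          simp only [hg]
          calc C * Real.log (|t + k| + 2) * (3 / (1 + (k : ℝ) ^ 2))
              ≤ C * (Real.log (|t| + 2) * (1 + Real.log (|(k : ℝ)| + 2) / Real.log 2)) *
                (3 / (1 + (k : ℝ) ^ 2)) := by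
                gcongr
                linarith
            _ = _ := by ring
  have hunion : ⋃ k : ℤ, Ioc (k : ℝ) (k + 1) = univ := iUnion_Ioc_intCast ℝ
  rw [← setLIntegral_univ, ← hunion]
  refine (lintegral_iUnion_le _ _).trans ?_
  refine (ENNReal.tsum_le_tsum hpiece).trans ?_
  rw [← ENNReal.ofReal_tsum_of_nonneg (fun k => by have := hg0 k; positivity)
    (hsum.mul_left _), tsum_mul_left]
  exact ENNReal.ofReal_le_ofReal (le_of_eq (by ring))

theorem ae_zetaMajorant_lt_top : ∀ᵐ w : ℝ, zetaMajorant w < ∞ := by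
  obtain ⟨C, hC, hCz⟩ := exists_lintegral_zetaMajorant_weighted_le
  have h := hCz 0
  have hm : Measurable fun y : ℝ => zetaMajorant (0 + y) * ENNReal.ofReal (1 / (1 + y ^ 2)) :=
    (measurable_zetaMajorant.comp (by fun_prop)).mul (by fun_prop)
  filter_upwards [ae_lt_top hm (h.trans_lt ENNReal.ofReal_lt_top).ne] with w hw
  rw [zero_add] at hw
  by_contra hne
  rw [not_lt, top_le_iff] at hne
  rw [hne, ENNReal.top_mul (by simp; positivity)] at hw
  exact lt_irrefl _ hw

/-- Supplies the fixed heights `±h` of the two horizontal segments that pass above and below the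
pole. -/
theorem exists_zetaMajorant_lt_top :
    ∃ h : ℝ, 1 ≤ h ∧ h ≤ 2 ∧ zetaMajorant h < ∞ ∧ zetaMajorant (-h) < ∞ := by
  have h1 := ae_zetaMajorant_lt_top
  have h2 : ∀ᵐ w : ℝ, zetaMajorant (-w) < ∞ :=
    (Measure.measurePreserving_neg (volume : Measure ℝ)).quasiMeasurePreserving.ae h1
  have h3 : ∀ᵐ w ∂(volume.restrict (Icc (1 : ℝ) 2)), w ∈ Icc (1 : ℝ) 2 ∧
      zetaMajorant w < ∞ ∧ zetaMajorant (-w) < ∞ := by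
    filter_upwards [ae_restrict_mem measurableSet_Icc, ae_restrict_of_ae h1,
      ae_restrict_of_ae h2] with w a b c using ⟨a, b, c⟩
  have : (ae (volume.restrict (Icc (1 : ℝ) 2))).NeBot := by
    rw [ae_neBot, Ne, Measure.restrict_eq_zero]
    simp
  obtain ⟨w, ⟨a, b⟩, c, d⟩ := h3.exists
  exact ⟨w, a, b, c, d⟩

/-- Some point of each unit interval does not exceed the mean. These heights carry the horizontal
edges that are sent to infinity. -/
theorem exists_zetaMajorant_le_log :
    ∃ C : ℝ, 0 ≤ C ∧ ∀ a : ℝ, ∃ w ∈ Ioc a (a + 1),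
      zetaMajorant w ≤ ENNReal.ofReal (C * Real.log (|a| + 2)) := by
  obtain ⟨C, hC, hCz⟩ := exists_lintegral_zetaMajorant_le
  refine ⟨C, hC, fun a => ?_⟩
  obtain ⟨w, hw, hle⟩ := exists_le_setLAverage (μ := volume) (s := Ioc a (a + 1))
    (f := zetaMajorant) (by simp) (by simp) measurable_zetaMajorant.aemeasurable
  refine ⟨w, hw, hle.trans ?_⟩
  rw [setLAverage_eq]
  simpa using hCz a

/-! ### The decay hypotheses in the form used on the contour. -/

theorem VerticalDecay.exists_bound {V : ℝ → ℝ → ℝ} {m : ℝ} (hii : VerticalDecay V m) :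
    ∃ C y₀ : ℝ, 0 ≤ C ∧ 1 ≤ y₀ ∧ ∀ X : ℝ, 2 ≤ X → ∀ u ∈ Icc (0 : ℝ) 1, ∀ y : ℝ, y₀ ≤ |y| →
      ‖weightFT (V X) ((u + y * Complex.I) / Complex.I)‖ ≤ C * (X ^ u / |y| ^ m) := by
  obtain ⟨C, y₀, hy₀, hC⟩ := hii 1 zero_le_one
  refine ⟨|C|, max y₀ 1, abs_nonneg _, le_max_right _ _, fun X hX u hu y hy => ?_⟩
  have hy1 : 1 ≤ |y| := (le_max_right _ _).trans hy
  have hX0 : 0 < X := by linarith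
  have hle : C * (X ^ u / |y| ^ m) ≤ |C| * (X ^ u / |y| ^ m) := by
    gcongr
    exact le_abs_self C
  refine le_trans ?_ hle
  have h := hC X hX (u + |y| * Complex.I) (by simpa using hu.1) (by simpa using hu.2)
    (by simpa using (le_max_left _ _).trans hy)
  have e1 : ((u : ℂ) + ((|y| : ℝ) : ℂ) * Complex.I).re = u := by simp
  have e2 : ((u : ℂ) + ((|y| : ℝ) : ℂ) * Complex.I).im = |y| := by simp
  rw [e1, e2, abs_abs] at h
  rcases le_total 0 y with h0 | h0
  · simpa only [abs_of_nonneg h0] using h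
  · have e3 : ((u : ℂ) + y * Complex.I) =
        (starRingEnd ℂ) ((u : ℂ) + ((|y| : ℝ) : ℂ) * Complex.I) := by
      rw [abs_of_nonpos h0]
      simp
    rw [e3, weightFT_conj, RCLike.norm_conj]
    exact h

/-- Rescaling `y` by `log X` gives `log X / (1 + (y log X)²)`, which for `|y| ≥ 1` is at most `2 /
(log X (1 + y²))`. The saved `1 / log X` later cancels the `log t` from the mean of `log ζ`. -/
theorem Concentrated.exists_bound {V : ℝ → ℝ → ℝ} (hiii : Concentrated V) :
    ∃ C : ℝ, 0 ≤ C ∧ ∀ X : ℝ, 2 ≤ X → ∀ y : ℝ, 1 ≤ |y| →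
      ‖weightFT (V X) (((0 : ℝ) + y * Complex.I) / Complex.I)‖ ≤
        C / Real.log X * (1 / (1 + y ^ 2)) := by
  obtain ⟨C, hC⟩ := hiii
  refine ⟨2 * |C|, by positivity, fun X hX y hy => ?_⟩
  have hl : 0 < Real.log X := Real.log_pos (by linarith)
  have h := hC X hX (y * Real.log X)
  rw [mul_div_cancel_right₀ _ hl.ne', weightFT_ofReal_eq, norm_mul, norm_div, norm_one,
    Complex.norm_real, Real.norm_of_nonneg hl.le, one_div_mul_eq_div, div_le_iff₀ hl] at h
  refine h.trans ?_
  have hy2 : 1 ≤ y ^ 2 := (one_le_sq_iff_one_le_abs y).2 hy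
  calc C * (1 / (1 + (y * Real.log X) ^ 2)) * Real.log X
      ≤ |C| * (1 / (1 + (y * Real.log X) ^ 2)) * Real.log X := by
        gcongr; exact le_abs_self C
    _ ≤ |C| * (2 / (Real.log X ^ 2 * (1 + y ^ 2))) * Real.log X := by
        gcongr |C| * ?_ * _
        rw [div_le_div_iff₀ (by positivity) (by positivity)]
        nlinarith [sq_nonneg (Real.log X), mul_nonneg (sq_nonneg (Real.log X)) (sub_nonneg.2 hy2)]
    _ = _ := by field_simp

/-- Continuity handles bounded heights, and `m ≥ 2` gives quadratic decay beyond. The constant may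
depend on the weight: it serves only convergence and vanishing of distant edges, never the final
bound. -/
theorem exists_uniform_weight_bound {v : ℝ → ℝ} (hv : Continuous v)
    (hint : ∀ c : ℝ, 0 ≤ c → Integrable (fun x : ℝ => Real.exp (c * x) * v x))
    {D y₀ m : ℝ} (hm : 2 ≤ m) (hD : 0 ≤ D) (hy₀ : 1 ≤ y₀)
    (hdec : ∀ u ∈ Icc (0 : ℝ) 1, ∀ y : ℝ, y₀ ≤ |y| →
      ‖weightFT v ((u + y * Complex.I) / Complex.I)‖ ≤ D / |y| ^ m) :
    ∃ B : ℝ, 0 ≤ B ∧ ∀ u ∈ Icc (0 : ℝ) 1, ∀ y : ℝ,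
      ‖weightFT v ((u + y * Complex.I) / Complex.I)‖ ≤ B * (1 / (1 + y ^ 2)) := by
  have hcont : ContinuousOn
      (fun p : ℝ × ℝ => weightFT v ((p.1 + p.2 * Complex.I) / Complex.I))
      (Icc 0 1 ×ˢ Icc (-y₀) y₀) := by
    refine (continuousOn_weightFT hv hint).comp
      (f := fun p : ℝ × ℝ => ((p.1 : ℂ) + p.2 * Complex.I)) (by fun_prop) ?_
    rintro ⟨u, y⟩ ⟨hu, -⟩
    simpa using hu.1
  obtain ⟨B, hB⟩ := (isCompact_Icc.prod isCompact_Icc).exists_bound_of_continuousOn hcont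
  refine ⟨|B| * (1 + y₀ ^ 2) + 2 * D, by positivity, fun u hu y => ?_⟩
  rcases le_total y₀ |y| with hy | hy
  · refine (hdec u hu y hy).trans ?_
    have hy1 : 1 ≤ |y| := hy₀.trans hy
    have h1 : y ^ 2 ≤ |y| ^ m := by
      rw [← sq_abs, ← Real.rpow_two]
      exact Real.rpow_le_rpow_of_exponent_le hy1 hm
    have hy2 : 1 ≤ y ^ 2 := (one_le_sq_iff_one_le_abs y).2 hy1
    calc D / |y| ^ m ≤ D / y ^ 2 := by gcongr
      _ ≤ 2 * D * (1 / (1 + y ^ 2)) := by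
          rw [mul_one_div, div_le_div_iff₀ (by positivity) (by positivity)]
          nlinarith
      _ ≤ _ := by
          gcongr
          have : 0 ≤ |B| * (1 + y₀ ^ 2) := by positivity
          linarith
  · have h1 := hB (u, y) ⟨hu, abs_le.1 hy⟩
    refine h1.trans ?_
    have h2 : y ^ 2 ≤ y₀ ^ 2 := sq_le_sq' (by linarith [(abs_le.1 hy).1]) (abs_le.1 hy).2
    rw [mul_one_div, le_div_iff₀ (by positivity)]
    calc B * (1 + y ^ 2) ≤ |B| * (1 + y₀ ^ 2) := by
          gcongr; exact le_abs_self B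
      _ ≤ _ := by linarith

/-! ### Moving the line of integration around the pole. -/

/-- Functions on the closed strip `0 ≤ Re z ≤ 1` that are holomorphic for `Re z > 0` and decay
like `(Im z)⁻²`. -/
structure StripDecay (W : ℂ → ℂ) (B : ℝ) : Prop where
  continuousOn : ContinuousOn W {z : ℂ | 0 ≤ z.re}
  differentiableAt : ∀ z : ℂ, 0 < z.re → DifferentiableAt ℂ W z
  bound : ∀ u ∈ Icc (0 : ℝ) 1, ∀ y : ℝ, ‖W (u + y * Complex.I)‖ ≤ B * (1 / (1 + y ^ 2))

namespace StripDecay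

variable {W : ℂ → ℂ} {B : ℝ}

theorem nonneg (hW : StripDecay W B) : 0 ≤ B := by
  have := (norm_nonneg _).trans (hW.bound 0 ⟨le_rfl, zero_le_one⟩ 0)
  simpa using this

theorem continuous_vertical (hW : StripDecay W B) {u : ℝ} (hu : 0 ≤ u) :
    Continuous fun y : ℝ => W (u + y * Complex.I) :=
  hW.continuousOn.comp_continuous (by fun_prop) fun y => by simpa using hu

theorem integrable_vertical (hW : StripDecay W B) {u : ℝ} (hu : u ∈ Icc (0 : ℝ) 1) :
    Integrable fun y : ℝ => W (u + y * Complex.I) := by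
  have h : Integrable fun y : ℝ => B * (1 / (1 + y ^ 2)) := by
    simpa [one_div] using integrable_inv_one_add_sq.const_mul B
  exact h.mono' (hW.continuous_vertical hu.1).aestronglyMeasurable
    (Eventually.of_forall fun y => hW.bound u hu y)

theorem enorm_logZeta_mul_le {σ t u y b : ℝ} (hσ : 1 / 2 ≤ σ) (hu : 0 ≤ u)
    (hb : ‖W (u + y * Complex.I)‖ ≤ b) :
    ‖logZeta (σ + t * Complex.I + (u + y * Complex.I)) * W (u + y * Complex.I)‖ₑ ≤
      zetaMajorant (t + y) * ENNReal.ofReal b := by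
  rw [enorm_mul]
  gcongr
  · have := enorm_logZeta_le (s := σ + t * Complex.I + (u + y * Complex.I)) (by simp at hσ ⊢; linarith)
    simpa using this
  · rw [← ofReal_norm]
    exact ENNReal.ofReal_le_ofReal hb

theorem lintegral_logZeta_mul_le {σ t u Q : ℝ} {S : Set ℝ} (hS : MeasurableSet S) (hQ0 : 0 ≤ Q)
    (hσ : 1 / 2 ≤ σ) (hu : 0 ≤ u)
    (hQ : ∀ y ∈ S, ‖W (u + y * Complex.I)‖ ≤ Q * (1 / (1 + y ^ 2))) :
    ∫⁻ y in S, ‖logZeta (σ + t * Complex.I + (u + y * Complex.I)) * W (u + y * Complex.I)‖ₑ ≤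
      ENNReal.ofReal Q * ∫⁻ y, zetaMajorant (t + y) * ENNReal.ofReal (1 / (1 + y ^ 2)) := by
  have hm : Measurable fun y : ℝ => zetaMajorant (t + y) * ENNReal.ofReal (1 / (1 + y ^ 2)) :=
    (measurable_zetaMajorant.comp (by fun_prop)).mul (by fun_prop)
  calc _ ≤ ∫⁻ y in S, ENNReal.ofReal Q *
        (zetaMajorant (t + y) * ENNReal.ofReal (1 / (1 + y ^ 2))) := by
        refine setLIntegral_mono' hS fun y hy => ?_
        refine (enorm_logZeta_mul_le hσ hu (hQ y hy)).trans (le_of_eq ?_)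
        rw [ENNReal.ofReal_mul hQ0]; ring
    _ ≤ ∫⁻ y, ENNReal.ofReal Q *
        (zetaMajorant (t + y) * ENNReal.ofReal (1 / (1 + y ^ 2))) := setLIntegral_le_lintegral _ _
    _ = _ := lintegral_const_mul _ hm

theorem lintegral_weighted_ne_top (t : ℝ) :
    ∫⁻ y : ℝ, zetaMajorant (t + y) * ENNReal.ofReal (1 / (1 + y ^ 2)) ≠ ∞ := by
  obtain ⟨C, -, hC⟩ := exists_lintegral_zetaMajorant_weighted_le
  exact ((hC t).trans_lt ENNReal.ofReal_lt_top).ne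

theorem integrable_logZeta_mul (hW : StripDecay W B) {σ t u : ℝ} (hσ : 1 / 2 ≤ σ)
    (hu : u ∈ Icc (0 : ℝ) 1) :
    Integrable fun y : ℝ =>
      logZeta (σ + t * Complex.I + (u + y * Complex.I)) * W (u + y * Complex.I) := by
  refine ⟨?_, ?_⟩
  · refine AEStronglyMeasurable.mul ?_ (hW.continuous_vertical hu.1).aestronglyMeasurable
    have h1 : Measurable fun y : ℝ => logZeta (((σ + u : ℝ) : ℂ) + ((t + y : ℝ) : ℂ) * Complex.I) :=
      (measurable_logZeta_vertical (σ + u)).comp (by fun_prop)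
    refine h1.aestronglyMeasurable.congr (Eventually.of_forall fun y => ?_)
    simp only
    congr 1
    push_cast
    ring
  · have h := lintegral_logZeta_mul_le (W := W) (t := t) MeasurableSet.univ hW.nonneg hσ hu.1
      fun y _ => hW.bound u hu y
    rw [setLIntegral_univ] at h
    exact h.trans_lt (ENNReal.mul_lt_top ENNReal.ofReal_lt_top
      (lintegral_weighted_ne_top t).lt_top)

theorem norm_setIntegral_logZeta_mul_le {σ t u Q : ℝ} {S : Set ℝ}
    (hS : MeasurableSet S) (hQ0 : 0 ≤ Q) (hσ : 1 / 2 ≤ σ) (hu : 0 ≤ u)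
    (hQ : ∀ y ∈ S, ‖W (u + y * Complex.I)‖ ≤ Q * (1 / (1 + y ^ 2))) :
    ‖∫ y in S, logZeta (σ + t * Complex.I + (u + y * Complex.I)) * W (u + y * Complex.I)‖ ≤
      Q * (∫⁻ y, zetaMajorant (t + y) * ENNReal.ofReal (1 / (1 + y ^ 2))).toReal := by
  have h := (enorm_integral_le_lintegral_enorm _).trans
    (lintegral_logZeta_mul_le (t := t) hS hQ0 hσ hu hQ)
  rw [← toReal_enorm]
  refine (ENNReal.toReal_mono (ENNReal.mul_ne_top ENNReal.ofReal_ne_top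
    (lintegral_weighted_ne_top t)) h).trans ?_
  rw [ENNReal.toReal_mul, ENNReal.toReal_ofReal hQ0]

theorem norm_horizontal_le {σ t c y P : ℝ} (hσ : 1 / 2 ≤ σ) (hc : 0 ≤ c)
    (hfin : zetaMajorant (t + y) < ∞)
    (hP : ∀ x ∈ Icc (0 : ℝ) c, ‖W (x + y * Complex.I)‖ ≤ P) :
    ‖∫ x in (0 : ℝ)..c,
      logZeta (σ + t * Complex.I + (x + y * Complex.I)) * W (x + y * Complex.I)‖ ≤
      c * ((zetaMajorant (t + y)).toReal * P) := by
  have hP0 : 0 ≤ P := (norm_nonneg _).trans (hP 0 ⟨le_rfl, hc⟩)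
  have := intervalIntegral.norm_integral_le_of_norm_le_const (a := 0) (b := c)
    (C := (zetaMajorant (t + y)).toReal * P)
    (f := fun x : ℝ => logZeta (σ + t * Complex.I + (x + y * Complex.I)) * W (x + y * Complex.I))
    (fun x hx => by
      rw [uIoc_of_le hc] at hx
      have h := enorm_logZeta_mul_le (t := t) hσ hx.1.le (hP x ⟨hx.1.le, hx.2⟩)
      rw [← toReal_enorm]
      refine (ENNReal.toReal_mono (ENNReal.mul_ne_top hfin.ne ENNReal.ofReal_ne_top) h).trans ?_
      rw [ENNReal.toReal_mul, ENNReal.toReal_ofReal hP0])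
  rw [sub_zero, abs_of_nonneg hc] at this
  linarith

/-- Cauchy's theorem for a rectangle that avoids the horizontal line through the pole. -/
theorem rectangle_identity (hRH : RiemannHypothesis) (hW : StripDecay W B) {σ t c b Y : ℝ}
    (hσ : 1 / 2 < σ) (hc : 0 ≤ c) (hbY : ∀ y ∈ uIcc b Y, t + y ≠ 0) :
    (∫ x in (0 : ℝ)..c,
        logZeta (σ + t * Complex.I + (x + b * Complex.I)) * W (x + b * Complex.I)) -
      (∫ x in (0 : ℝ)..c,
        logZeta (σ + t * Complex.I + (x + Y * Complex.I)) * W (x + Y * Complex.I)) +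
      Complex.I * (∫ y in b..Y,
        logZeta (σ + t * Complex.I + (c + y * Complex.I)) * W (c + y * Complex.I)) -
      Complex.I * (∫ y in b..Y, logZeta (σ + t * Complex.I + ((0 : ℝ) + y * Complex.I)) *
        W ((0 : ℝ) + y * Complex.I)) = 0 := by
  have hd : ∀ z : ℂ, 0 ≤ z.re → z.im ∈ uIcc b Y →
      DifferentiableAt ℂ (fun z => logZeta (σ + t * Complex.I + z)) z := by
    intro z hz hz2
    refine DifferentiableAt.comp z (g := logZeta) (f := fun z => σ + t * Complex.I + z)
      (differentiableAt_logZeta hRH ?_ ?_) (by fun_prop)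
    · simp at hσ ⊢; linarith
    · simpa using hbY _ hz2
  have h := Complex.integral_boundary_rect_eq_zero_of_continuousOn_of_differentiableOn
    (fun z => logZeta (σ + t * Complex.I + z) * W z) ⟨0, b⟩ ⟨c, Y⟩ ?_ ?_
  · simpa using h
  · rintro z ⟨hz1, hz2⟩
    simp only [uIcc_of_le hc, mem_preimage] at hz1 hz2
    refine ContinuousWithinAt.mul (hd z hz1.1 hz2).continuousAt.continuousWithinAt ?_
    refine (hW.continuousOn z hz1.1).mono ?_
    rintro w ⟨hw1, -⟩
    simp only [uIcc_of_le hc, mem_preimage] at hw1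
    exact hw1.1
  · rintro z ⟨hz1, hz2⟩
    simp only [min_eq_left hc, max_eq_right hc, mem_preimage] at hz1 hz2
    exact ((hd z hz1.1.le (Ioo_subset_Icc_self hz2)).mul
      (hW.differentiableAt z hz1.1)).differentiableWithinAt

/-- Quadratic decay of `W` beats the growth of the majorant at good heights; a linear bound for the
latter is enough. -/
theorem tendsto_horizontal (hW : StripDecay W B) {σ t c : ℝ} (hσ : 1 / 2 ≤ σ) (hc : 0 ≤ c)
    (hc1 : c ≤ 1) {C : ℝ} (hC : 0 ≤ C) {Y : ℕ → ℝ} (hY : ∀ n : ℕ, (n : ℝ) ≤ |Y n|)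
    (hYL : ∀ n : ℕ, zetaMajorant (t + Y n) ≤ ENNReal.ofReal (C * (|t| + n + 3))) :
    Tendsto (fun n => ∫ x in (0 : ℝ)..c,
      logZeta (σ + t * Complex.I + (x + Y n * Complex.I)) * W (x + Y n * Complex.I)) atTop
      (𝓝 0) := by
  have hB := hW.nonneg
  have hbd : ∀ n : ℕ, ‖∫ x in (0 : ℝ)..c,
      logZeta (σ + t * Complex.I + (x + Y n * Complex.I)) * W (x + Y n * Complex.I)‖ ≤
      C * B * ((|t| + 3) * (1 / (1 + (n : ℝ) ^ 2)) + n / (1 + (n : ℝ) ^ 2)) := by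
    intro n
    have h2 : (n : ℝ) ^ 2 ≤ Y n ^ 2 := by
      rw [← sq_abs (Y n)]; exact pow_le_pow_left₀ n.cast_nonneg (hY n) 2
    have h3 := norm_horizontal_le (W := W) (t := t) (y := Y n) (P := B * (1 / (1 + (n : ℝ) ^ 2)))
      hσ hc ((hYL n).trans_lt ENNReal.ofReal_lt_top) (fun x hx => by
        refine (hW.bound x ⟨hx.1, hx.2.trans hc1⟩ _).trans ?_
        gcongr)
    refine h3.trans ?_
    have h4 : (zetaMajorant (t + Y n)).toReal ≤ C * (|t| + n + 3) := by
      refine (ENNReal.toReal_mono ENNReal.ofReal_ne_top (hYL n)).trans ?_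
      rw [ENNReal.toReal_ofReal (by positivity)]
    calc c * ((zetaMajorant (t + Y n)).toReal * (B * (1 / (1 + (n : ℝ) ^ 2))))
        ≤ 1 * ((C * (|t| + n + 3)) * (B * (1 / (1 + (n : ℝ) ^ 2)))) := by gcongr
      _ = _ := by ring
  refine squeeze_zero_norm hbd ?_
  have hn : Tendsto (fun n : ℕ => (n : ℝ)) atTop atTop := tendsto_natCast_atTop_atTop
  have h1 : Tendsto (fun n : ℕ => 1 / (1 + (n : ℝ) ^ 2)) atTop (𝓝 0) := by
    refine Tendsto.div_atTop tendsto_const_nhds ?_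
    exact tendsto_atTop_add_const_left _ _ ((tendsto_pow_atTop two_ne_zero).comp hn)
  have h2 : Tendsto (fun n : ℕ => (n : ℝ) / (1 + (n : ℝ) ^ 2)) atTop (𝓝 0) := by
    have h3 : Tendsto (fun n : ℕ => 1 / (n : ℝ)) atTop (𝓝 0) := tendsto_one_div_atTop_nhds_zero_nat
    refine squeeze_zero (fun n => by positivity) (fun n => ?_) h3
    rcases Nat.eq_zero_or_pos n with rfl | hn
    · simp
    · have : (0 : ℝ) < n := by exact_mod_cast hn
      rw [div_le_div_iff₀ (by positivity) this]
      nlinarith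
  simpa using ((h1.const_mul (|t| + 3)).add h2).const_mul (C * B)

theorem log_le_add {t a : ℝ} {n : ℕ} (h : |a| ≤ |t| + n + 1) :
    Real.log (|a| + 2) ≤ |t| + n + 3 := by
  have := Real.log_le_sub_one_of_pos (show 0 < |a| + 2 by positivity)
  linarith

theorem setIntegral_Ioi_shift (hRH : RiemannHypothesis) (hW : StripDecay W B) {σ t c b : ℝ}
    (hσ : 1 / 2 < σ) (hc : 0 ≤ c) (hc1 : c ≤ 1) (hb : 0 < t + b) :
    ∫ y in Ioi b, logZeta (σ + t * Complex.I + (c + y * Complex.I)) * W (c + y * Complex.I) =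
      (∫ y in Ioi b, logZeta (σ + t * Complex.I + ((0 : ℝ) + y * Complex.I)) *
        W ((0 : ℝ) + y * Complex.I)) +
      Complex.I * ∫ x in (0 : ℝ)..c,
        logZeta (σ + t * Complex.I + (x + b * Complex.I)) * W (x + b * Complex.I) := by
  obtain ⟨C, hC, hCw⟩ := exists_zetaMajorant_le_log
  choose w hw hwL using hCw
  -- Heights are measured relative to `t`, so that `s + z` has imaginary part exactly the good
  -- height `w (t + n)`.
  set Y : ℕ → ℝ := fun n => w (t + n) - t with hY
  have hYn : ∀ n : ℕ, (n : ℝ) ≤ Y n := fun n => by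
    have := (hw (t + n)).1
    simp only [hY]; linarith
  have hYtop : Tendsto Y atTop atTop := tendsto_atTop_mono hYn tendsto_natCast_atTop_atTop
  have hhor := hW.tendsto_horizontal (σ := σ) (t := t) hσ.le hc hc1 hC (Y := Y)
    (fun n => (hYn n).trans (le_abs_self _)) (fun n => by
      simp only [hY, add_sub_cancel]
      refine (hwL _).trans (ENNReal.ofReal_le_ofReal ?_)
      gcongr
      apply log_le_add
      refine (abs_add_le _ _).trans ?_
      simp)
  have hi1 := (hW.integrable_logZeta_mul (σ := σ) (t := t) hσ.le ⟨hc, hc1⟩).integrableOn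
    (s := Ioi b)
  have hi0 := (hW.integrable_logZeta_mul (σ := σ) (t := t) hσ.le
    (show (0 : ℝ) ∈ Icc (0 : ℝ) 1 from ⟨le_rfl, zero_le_one⟩)).integrableOn (s := Ioi b)
  have t1 := intervalIntegral_tendsto_integral_Ioi b hi1 hYtop
  have t0 := intervalIntegral_tendsto_integral_Ioi b hi0 hYtop
  set H := ∫ x in (0 : ℝ)..c,
        logZeta (σ + t * Complex.I + (x + b * Complex.I)) * W (x + b * Complex.I) with hH
  have hlim := ((hhor.const_sub H).add (t1.const_mul Complex.I)).sub (t0.const_mul Complex.I)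
  have hz := tendsto_nhds_unique (hlim.congr' (f₂ := fun _ => (0 : ℂ)) ?_) tendsto_const_nhds
  · have hI := Complex.I_mul_I
    linear_combination (-Complex.I) * hz + ((∫ y in Ioi b,
      logZeta (σ + t * Complex.I + (c + y * Complex.I)) * W (c + y * Complex.I)) -
      ∫ y in Ioi b, logZeta (σ + t * Complex.I + ((0 : ℝ) + y * Complex.I)) *
        W ((0 : ℝ) + y * Complex.I)) * hI
  · filter_upwards [hYtop.eventually_ge_atTop b] with n hn
    refine rectangle_identity hRH hW hσ hc fun y hy => ?_
    rw [uIcc_of_le hn] at hy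
    linarith [hy.1]

theorem setIntegral_Iic_shift (hRH : RiemannHypothesis) (hW : StripDecay W B) {σ t c b : ℝ}
    (hσ : 1 / 2 < σ) (hc : 0 ≤ c) (hc1 : c ≤ 1) (hb : t + b < 0) :
    ∫ y in Iic b, logZeta (σ + t * Complex.I + (c + y * Complex.I)) * W (c + y * Complex.I) =
      (∫ y in Iic b, logZeta (σ + t * Complex.I + ((0 : ℝ) + y * Complex.I)) *
        W ((0 : ℝ) + y * Complex.I)) -
      Complex.I * ∫ x in (0 : ℝ)..c,
        logZeta (σ + t * Complex.I + (x + b * Complex.I)) * W (x + b * Complex.I) := by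
  obtain ⟨C, hC, hCw⟩ := exists_zetaMajorant_le_log
  choose w hw hwL using hCw
  set Y : ℕ → ℝ := fun n => w (t - n - 1) - t with hY
  have hYn : ∀ n : ℕ, Y n ≤ -(n : ℝ) := fun n => by
    have := (hw (t - n - 1)).2
    simp only [hY]; linarith
  have hYbot : Tendsto Y atTop atBot :=
    tendsto_atBot_mono hYn (tendsto_neg_atTop_atBot.comp tendsto_natCast_atTop_atTop)
  have hhor := hW.tendsto_horizontal (σ := σ) (t := t) hσ.le hc hc1 hC (Y := Y)
    (fun n => by have := neg_le_abs (Y n); linarith [hYn n]) (fun n => by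
      simp only [hY, add_sub_cancel]
      refine (hwL _).trans (ENNReal.ofReal_le_ofReal ?_)
      gcongr
      apply log_le_add
      rw [sub_sub]
      refine (abs_sub _ _).trans ?_
      rw [abs_of_nonneg (show (0 : ℝ) ≤ n + 1 by positivity)]
      linarith)
  have hi1 := (hW.integrable_logZeta_mul (σ := σ) (t := t) hσ.le ⟨hc, hc1⟩).integrableOn
    (s := Iic b)
  have hi0 := (hW.integrable_logZeta_mul (σ := σ) (t := t) hσ.le
    (show (0 : ℝ) ∈ Icc (0 : ℝ) 1 from ⟨le_rfl, zero_le_one⟩)).integrableOn (s := Iic b)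
  have t1 := intervalIntegral_tendsto_integral_Iic b hi1 hYbot
  have t0 := intervalIntegral_tendsto_integral_Iic b hi0 hYbot
  set H := ∫ x in (0 : ℝ)..c,
        logZeta (σ + t * Complex.I + (x + b * Complex.I)) * W (x + b * Complex.I) with hH
  have hlim := ((hhor.sub_const H).add (t1.const_mul Complex.I)).sub (t0.const_mul Complex.I)
  have hz := tendsto_nhds_unique (hlim.congr' (f₂ := fun _ => (0 : ℂ)) ?_) tendsto_const_nhds
  · have hI := Complex.I_mul_I
    linear_combination (-Complex.I) * hz + ((∫ y in Iic b,
      logZeta (σ + t * Complex.I + (c + y * Complex.I)) * W (c + y * Complex.I)) -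
      ∫ y in Iic b, logZeta (σ + t * Complex.I + ((0 : ℝ) + y * Complex.I)) *
        W ((0 : ℝ) + y * Complex.I)) * hI
  · filter_upwards [hYbot.eventually_le_atBot b] with n hn
    refine rectangle_identity hRH hW hσ hc fun y hy => ?_
    rw [uIcc_of_le hn] at hy
    linarith [hy.2]

/-- The main estimate: comparison of the integral over `Re z = c` with the integral over the
central part of `Re z = 0`. -/
theorem norm_integral_sub_integral_le (hRH : RiemannHypothesis) (hW : StripDecay W B)
    {σ t c h P Q : ℝ} (hσ : 1 / 2 < σ) (hc : 0 ≤ c) (hc1 : c ≤ 1) (h1 : 1 ≤ h) (h2 : h ≤ 2)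
    (hfin : zetaMajorant h < ∞) (hfin' : zetaMajorant (-h) < ∞)
    (hcen : ∫⁻ w in Ioc (-2 : ℝ) 2, zetaMajorant w ≠ ∞) (ht : 4 ≤ t)
    (hP : ∀ x ∈ Icc (0 : ℝ) c, ∀ y : ℝ, |t + y| ≤ 2 → ‖W (x + y * Complex.I)‖ ≤ P)
    (hQ0 : 0 ≤ Q)
    (hQ : ∀ y : ℝ, 1 ≤ |y| → ‖W ((0 : ℝ) + y * Complex.I)‖ ≤ Q * (1 / (1 + y ^ 2))) :
    ‖(∫ y : ℝ, logZeta (σ + t * Complex.I + (c + y * Complex.I)) * W (c + y * Complex.I)) -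
      ∫ y in (-1 : ℝ)..1, logZeta (σ + t * Complex.I + ((0 : ℝ) + y * Complex.I)) *
        W ((0 : ℝ) + y * Complex.I)‖ ≤
      P * ((zetaMajorant h).toReal + (zetaMajorant (-h)).toReal +
        (∫⁻ w in Ioc (-2 : ℝ) 2, zetaMajorant w).toReal) +
      3 * (Q * (∫⁻ y, zetaMajorant (t + y) * ENNReal.ofReal (1 / (1 + y ^ 2))).toReal) := by
  have hP0 : 0 ≤ P := (norm_nonneg _).trans (hP 0 ⟨le_rfl, hc⟩ (-t) (by simp))
  set F : ℝ → ℝ → ℂ := fun u y =>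
    logZeta (σ + t * Complex.I + (u + y * Complex.I)) * W (u + y * Complex.I) with hF
  have hi1 : Integrable (F c) := hW.integrable_logZeta_mul hσ.le ⟨hc, hc1⟩
  have hi0 : Integrable (F 0) := hW.integrable_logZeta_mul hσ.le ⟨le_rfl, zero_le_one⟩
  -- Between `b₁` and `b₂` the contour stays on `Re z = c`, since moving left could cross the cut of
  -- `logZeta`. As `t ≥ 4` and `h ≤ 2`, both heights lie below `-1`, away from the central segment.
  set b₁ := -t - h with hb₁
  set b₂ := -t + h with hb₂
  have hs1 : ∫ y, F c y =
      (∫ y in Iic b₁, F c y) + ((∫ y in Ioc b₁ b₂, F c y) + ∫ y in Ioi b₂, F c y) := by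
    rw [← setIntegral_union (Ioc_disjoint_Ioi le_rfl) measurableSet_Ioi hi1.integrableOn
      hi1.integrableOn, Ioc_union_Ioi_eq_Ioi (by linarith),
      ← setIntegral_union (Iic_disjoint_Ioi le_rfl) measurableSet_Ioi hi1.integrableOn
      hi1.integrableOn, Iic_union_Ioi, setIntegral_univ]
  have hs0 : ∫ y in Ioi b₂, F 0 y =
      (∫ y in Ioc b₂ (-1), F 0 y) + ((∫ y in (-1 : ℝ)..1, F 0 y) + ∫ y in Ioi 1, F 0 y) := by
    rw [intervalIntegral.integral_of_le (by norm_num),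
      ← setIntegral_union (Ioc_disjoint_Ioi le_rfl) measurableSet_Ioi hi0.integrableOn
      hi0.integrableOn, Ioc_union_Ioi_eq_Ioi (by norm_num),
      ← setIntegral_union (Ioc_disjoint_Ioi le_rfl) measurableSet_Ioi hi0.integrableOn
      hi0.integrableOn, Ioc_union_Ioi_eq_Ioi (by linarith)]
  have hup : ∫ y in Ioi b₂, F c y = (∫ y in Ioi b₂, F 0 y) +
      Complex.I * ∫ x in (0 : ℝ)..c, F x b₂ :=
    setIntegral_Ioi_shift hRH hW hσ hc hc1 (by linarith)
  have hlo : ∫ y in Iic b₁, F c y = (∫ y in Iic b₁, F 0 y) -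
      Complex.I * ∫ x in (0 : ℝ)..c, F x b₁ :=
    setIntegral_Iic_shift hRH hW hσ hc hc1 (by linarith)
  have hsub : ∀ S : Set ℝ, MeasurableSet S → (∀ y ∈ S, 1 ≤ |y|) → ‖∫ y in S, F 0 y‖ ≤
      Q * (∫⁻ y, zetaMajorant (t + y) * ENNReal.ofReal (1 / (1 + y ^ 2))).toReal :=
    fun S hS hS1 => norm_setIntegral_logZeta_mul_le hS hQ0 hσ.le le_rfl fun y hy => hQ y (hS1 y hy)
  have n1 := hsub (Iic b₁) measurableSet_Iic fun y hy => by
    have : y ≤ b₁ := hy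
    rw [abs_of_neg (by linarith)]; linarith
  have n2 := hsub (Ioc b₂ (-1)) measurableSet_Ioc fun y hy => by
    rw [abs_of_neg (by linarith [hy.2])]; linarith [hy.2]
  have n3 := hsub (Ioi 1) measurableSet_Ioi fun y hy => by
    have : 1 < y := hy
    rw [abs_of_pos (by linarith)]; linarith
  have hor : ∀ k : ℝ, |k| ≤ 2 → zetaMajorant k < ∞ →
      ‖Complex.I * ∫ x in (0 : ℝ)..c, F x (-t + k)‖ ≤ (zetaMajorant k).toReal * P := by
    intro k hk hkf
    have := norm_horizontal_le (W := W) (σ := σ) (t := t) (y := -t + k) (P := P) hσ.le hc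
      (by rwa [add_neg_cancel_left]) (fun x hx => hP x hx _ (by rwa [add_neg_cancel_left]))
    rw [add_neg_cancel_left] at this
    rw [norm_mul, Complex.norm_I, one_mul]
    refine this.trans ?_
    exact mul_le_of_le_one_left (mul_nonneg ENNReal.toReal_nonneg hP0) hc1
  have n4 := hor h (by rw [abs_of_pos (by linarith)]; exact h2) hfin
  have n5 := hor (-h) (by rw [abs_neg, abs_of_pos (by linarith)]; exact h2) hfin'
  have n6 : ‖∫ y in Ioc b₁ b₂, F c y‖ ≤
      P * (∫⁻ w in Ioc (-2 : ℝ) 2, zetaMajorant w).toReal := by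
    have hle : ∫⁻ y in Ioc b₁ b₂, ‖F c y‖ₑ ≤
        (∫⁻ w in Ioc (-2 : ℝ) 2, zetaMajorant w) * ENNReal.ofReal P := by
      calc ∫⁻ y in Ioc b₁ b₂, ‖F c y‖ₑ
          ≤ ∫⁻ y in Ioc b₁ b₂, zetaMajorant (t + y) * ENNReal.ofReal P := by
            refine setLIntegral_mono' measurableSet_Ioc fun y hy => ?_
            refine enorm_logZeta_mul_le hσ.le hc (hP c ⟨hc, le_rfl⟩ y ?_)
            rw [abs_le]; constructor <;> linarith [hy.1, hy.2]
        _ = (∫⁻ y in Ioc b₁ b₂, zetaMajorant (t + y)) * ENNReal.ofReal P :=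
            lintegral_mul_const _ (measurable_zetaMajorant.comp (by fun_prop))
        _ ≤ _ := by
            gcongr 1
            have hmp := (measurePreserving_add_left volume t).setLIntegral_comp_preimage
              (s := Ioc (-2 : ℝ) 2) measurableSet_Ioc measurable_zetaMajorant
            rw [← hmp]
            refine lintegral_mono_set fun y hy => ?_
            constructor <;> simp only <;> linarith [hy.1, hy.2]
    rw [← toReal_enorm]
    refine (ENNReal.toReal_mono (ENNReal.mul_ne_top hcen ENNReal.ofReal_ne_top)
      ((enorm_integral_le_lintegral_enorm _).trans hle)).trans ?_
    rw [ENNReal.toReal_mul, ENNReal.toReal_ofReal hP0, mul_comm]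
  -- Three pieces of `Re z = 0` with `|y| ≥ 1` are each controlled by `Q`; the two connecting
  -- segments and the piece left on `Re z = c` lie near the pole height and are controlled by `P`.
  have hdecomp : (∫ y, F c y) - ∫ y in (-1 : ℝ)..1, F 0 y =
      (∫ y in Iic b₁, F 0 y) + (∫ y in Ioc b₂ (-1), F 0 y) + (∫ y in Ioi 1, F 0 y) +
      (Complex.I * ∫ x in (0 : ℝ)..c, F x (-t + h)) -
      (Complex.I * ∫ x in (0 : ℝ)..c, F x (-t + -h)) + ∫ y in Ioc b₁ b₂, F c y := by
    rw [← sub_eq_add_neg, hs1, hup, hlo, hs0]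
    ring
  change ‖(∫ y, F c y) - ∫ y in (-1 : ℝ)..1, F 0 y‖ ≤ _
  rw [hdecomp]
  refine (norm_add_le _ _).trans ?_
  have q1 := norm_sub_le ((∫ y in Iic b₁, F 0 y) + (∫ y in Ioc b₂ (-1), F 0 y) +
    (∫ y in Ioi 1, F 0 y) + (Complex.I * ∫ x in (0 : ℝ)..c, F x (-t + h)))
    (Complex.I * ∫ x in (0 : ℝ)..c, F x (-t + -h))
  have q2 := norm_add_le ((∫ y in Iic b₁, F 0 y) + (∫ y in Ioc b₂ (-1), F 0 y) +
    (∫ y in Ioi 1, F 0 y)) (Complex.I * ∫ x in (0 : ℝ)..c, F x (-t + h))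
  have q3 := norm_add₃_le (a := ∫ y in Iic b₁, F 0 y) (b := ∫ y in Ioc b₂ (-1), F 0 y)
    (c := ∫ y in Ioi 1, F 0 y)
  linarith

end StripDecay

/-! ### From the sum to a vertical integral, and the limit `σ → 1/2`. -/

/-- The weighted sum as an integral of `log ζ` over a line in the half plane of absolute
convergence. -/
theorem hasSum_weightedTerm {v : ℝ → ℝ} (hv : Continuous v)
    (hint : ∀ c : ℝ, 0 ≤ c → Integrable (fun x : ℝ => Real.exp (c * x) * v x)) {B : ℝ}
    (hW : StripDecay (fun z => weightFT v (z / Complex.I)) B) {σ t c : ℝ}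
    (hc : c ∈ Icc (0 : ℝ) 1) (hσc : 1 < σ + c) :
    HasSum (weightedTerm v σ t) (1 / (2 * (Real.pi : ℂ)) *
      ∫ y : ℝ, logZeta (σ + t * Complex.I + (c + y * Complex.I)) *
        weightFT v ((c + y * Complex.I) / Complex.I)) := by
  set W : ℝ → ℂ := fun y => weightFT v ((c + y * Complex.I) / Complex.I) with hWdef
  have hWi : Integrable W := hW.integrable_vertical hc
  set s : ℝ → ℂ := fun y => σ + t * Complex.I + (c + y * Complex.I) with hs
  have hsre : ∀ y, (s y).re = σ + c := fun y => by simp [hs]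
  set F : ℕ → ℝ → ℂ := fun n y => LSeries.term logZetaCoeff (s y) n * W y with hF
  have hnorm : ∀ n y, ‖LSeries.term logZetaCoeff (s y) n‖ =
      ‖LSeries.term logZetaCoeff ((σ + c : ℝ) : ℂ) n‖ := by
    intro n y
    rw [LSeries.norm_term_eq, LSeries.norm_term_eq, hsre, Complex.ofReal_re]
  have hcterm : ∀ n : ℕ, n ≠ 0 → ∀ y, LSeries.term logZetaCoeff (s y) n =
      logZetaCoeff n * Complex.exp (-(Real.log n : ℂ) * (s y)) := by
    intro n hn y
    have hn0 : (n : ℂ) ≠ 0 := by exact_mod_cast hn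
    rw [LSeries.term_of_ne_zero hn, div_eq_mul_inv, ← Complex.cpow_neg,
      Complex.cpow_def_of_ne_zero hn0, ← Complex.natCast_log]
    ring_nf
  have hFi : ∀ n, Integrable (F n) := by
    intro n
    refine hWi.bdd_mul (c := ‖LSeries.term logZetaCoeff ((σ + c : ℝ) : ℂ) n‖) ?_
      (Eventually.of_forall fun y => (hnorm n y).le)
    rcases eq_or_ne n 0 with rfl | hn
    · simp only [LSeries.term_zero]; fun_prop
    · rw [funext (hcterm n hn)]
      simp only [hs]
      fun_prop
  have hsum : Summable fun n => ∫ y, ‖F n y‖ := by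
    have h1 : ∀ n, ∫ y, ‖F n y‖ = ‖LSeries.term logZetaCoeff ((σ + c : ℝ) : ℂ) n‖ *
        ∫ y, ‖W y‖ := by
      intro n
      simp only [hF, norm_mul, hnorm]
      rw [integral_const_mul]
    simp_rw [h1]
    exact (LSeriesSummable_logZetaCoeff (by simpa using hσc)).norm.mul_right _
  have h1 := (hasSum_integral_of_summable_integral_norm hFi hsum).mul_left
    (1 / (2 * (Real.pi : ℂ)))
  have h2 : ∀ y, ∑' n, F n y = logZeta (s y) * W y := by
    intro y
    rw [logZeta_eq_LSeries (by rw [hsre]; exact hσc), LSeries, ← tsum_mul_right]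
  simp_rw [h2] at h1
  suffices heq : weightedTerm v σ t = fun n => 1 / (2 * (Real.pi : ℂ)) * ∫ y, F n y by
    rw [heq]; exact h1
  funext n
  rcases eq_or_ne n 0 with rfl | hn
  · simp [weightedTerm, hF]
  have hn0 : (n : ℂ) ≠ 0 := by exact_mod_cast hn
  have h3 : ∀ y, F n y = (logZetaCoeff n * Complex.exp (-(Real.log n : ℂ) * (σ + t * Complex.I))) *
      (Complex.exp (-(Real.log n : ℂ) * (c + y * Complex.I)) * W y) := by
    intro y
    simp only [hF]
    rw [hcterm n hn y, show s y = (σ + t * Complex.I) + (c + y * Complex.I) from rfl, mul_add,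
      Complex.exp_add]
    ring
  simp_rw [h3]
  rw [integral_const_mul, weightedTerm, weight_eq_integral hv hint hc.1 hWi (Real.log n),
    Complex.cpow_def_of_ne_zero hn0, ← Complex.natCast_log, neg_mul, Complex.exp_neg, logZetaCoeff]
  push_cast
  rw [← Complex.natCast_log]
  simp only [hWdef]
  field_simp
  simp only [mul_comm Complex.I]

theorem lintegral_zetaMajorant_center_ne_top :
    ∫⁻ w in Ioc (-2 : ℝ) 2, zetaMajorant w ≠ ∞ := by
  have h := StripDecay.lintegral_weighted_ne_top 0
  have hle : ∫⁻ w in Ioc (-2 : ℝ) 2, zetaMajorant w ≤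
      5 * ∫⁻ y : ℝ, zetaMajorant (0 + y) * ENNReal.ofReal (1 / (1 + y ^ 2)) := by
    rw [← lintegral_const_mul' _ _ (by simp)]
    refine (setLIntegral_mono' measurableSet_Ioc fun w hw => ?_).trans
      (setLIntegral_le_lintegral (Ioc (-2 : ℝ) 2) _)
    rw [zero_add, mul_left_comm]
    refine le_mul_of_one_le_right zero_le ?_
    rw [show (5 : ℝ≥0∞) = ENNReal.ofReal 5 by simp, ← ENNReal.ofReal_mul (by norm_num)]
    rw [ENNReal.one_le_ofReal, mul_one_div, le_div_iff₀ (by positivity)]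
    nlinarith [hw.1, hw.2]
  exact (hle.trans_lt (ENNReal.mul_lt_top (by simp) h.lt_top)).ne

theorem central_integrand_eq (v : ℝ → ℝ) (σ t y : ℝ) :
    logZeta ((σ : ℂ) + Complex.I * ((y : ℂ) + t)) * weightFT v (y : ℂ) =
      logZeta (σ + t * Complex.I + ((0 : ℝ) + y * Complex.I)) *
        weightFT v (((0 : ℝ) + y * Complex.I) / Complex.I) := by
  rw [weightFT_ofReal_eq v y]
  congr 2
  push_cast
  ring

/-- In the range of the theorem, `X ^ (Re z) / |Im z| ^ m` is bounded near the pole. -/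
theorem rpow_div_rpow_le {m T t X σ x y : ℝ} (hm : 0 ≤ m) (hT : Real.exp 2 ≤ T) (hT4 : 4 ≤ T)
    (hTt : T ≤ t) (hX1 : 1 ≤ X) (hX : X ≤ T ^ (2 * m)) (hσ : 1 / 2 ≤ σ)
    (hx : x ≤ 1 - σ + 1 / Real.log T) (hy : |t + y| ≤ 2) :
    X ^ x / |y| ^ m ≤ Real.exp (2 * m) * 2 ^ m := by
  have hT0 : 0 < T := by linarith
  have hl : 2 ≤ Real.log T := (Real.le_log_iff_exp_le hT0).2 hT
  have hyT : T / 2 ≤ |y| := by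
    have h1 : -|y| ≤ y := neg_abs_le y
    have h2 := (abs_le.1 hy).2
    linarith
  have h1 : X ^ x ≤ Real.exp (2 * m) * T ^ m := by
    calc X ^ x ≤ X ^ (1 / 2 + 1 / Real.log T) :=
          Real.rpow_le_rpow_of_exponent_le hX1 (by linarith)
      _ ≤ (T ^ (2 * m)) ^ (1 / 2 + 1 / Real.log T) :=
          Real.rpow_le_rpow (by linarith) hX (by positivity)
      -- The exponent is `2m (1/2 + 1 / log T)`, and `T^(1 / log T) = e`. Here the limit `X ≤
      -- T^(2m)` exactly matches the decay `|y|^(-m)`.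
      _ = Real.exp (2 * m) * T ^ m := by
          rw [← Real.rpow_mul hT0.le, Real.rpow_def_of_pos hT0, Real.rpow_def_of_pos hT0,
            ← Real.exp_add]
          congr 1
          field_simp
          ring
  have h2 : (T / 2) ^ m ≤ |y| ^ m := Real.rpow_le_rpow (by positivity) hyT hm
  rw [Real.div_rpow hT0.le (by norm_num)] at h2
  have hTm : 0 < T ^ m := by positivity
  have h2m : (0 : ℝ) < 2 ^ m := by positivity
  calc X ^ x / |y| ^ m ≤ (Real.exp (2 * m) * T ^ m) / (T ^ m / 2 ^ m) := by gcongr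
    _ = _ := by field_simp

/-- The terms at `σ = 1/2` dominate those at every larger `σ`. -/
theorem tendsto_tsum_weightedTerm {v : ℝ → ℝ} {t : ℝ} (hs : Summable (weightedTerm v (1 / 2) t))
    {σ : ℕ → ℝ} (hσ : ∀ n, 1 / 2 ≤ σ n) (hlim : Tendsto σ atTop (𝓝 (1 / 2))) :
    Tendsto (fun k => ∑' n, weightedTerm v (σ k) t n) atTop
      (𝓝 (∑' n, weightedTerm v (1 / 2) t n)) := by
  refine tendsto_tsum_of_dominated_convergence hs.norm ?_ ?_
  · intro n
    rcases eq_or_ne n 0 with rfl | hn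
    · simp [weightedTerm]
    rcases eq_or_ne n 1 with rfl | hn1
    · simp [weightedTerm]
    have hn0 : (n : ℂ) ≠ 0 := by exact_mod_cast hn
    have hlog : ((Real.log n : ℝ) : ℂ) ≠ 0 := by
      have : 0 < Real.log n := Real.log_pos (by exact_mod_cast (by omega : 1 < n))
      exact_mod_cast this.ne'
    unfold weightedTerm
    have hc : Continuous fun x : ℝ => (n : ℂ) ^ ((x : ℂ) + t * Complex.I) := by
      refine Continuous.const_cpow (by fun_prop) (Or.inl hn0)
    refine Tendsto.div tendsto_const_nhds (Tendsto.mul_const _ ?_) ?_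
    · exact (hc.tendsto (1 / 2)).comp hlim
    · refine mul_ne_zero ?_ hlog
      simp [Complex.cpow_eq_zero_iff, hn0]
  · refine Eventually.of_forall fun k n => ?_
    rcases eq_or_ne n 0 with rfl | hn
    · simp [weightedTerm]
    have hn1 : (1 : ℝ) ≤ n := by exact_mod_cast Nat.one_le_iff_ne_zero.2 hn
    have hnp : ∀ x : ℝ, ‖(n : ℂ) ^ ((x : ℂ) + t * Complex.I)‖ = (n : ℝ) ^ x := by
      intro x
      rw [Complex.norm_natCast_cpow_of_pos (Nat.pos_of_ne_zero hn)]
      simp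
    unfold weightedTerm
    rw [norm_div, norm_div, norm_mul _ ((Real.log n : ℝ) : ℂ), norm_mul _ ((Real.log n : ℝ) : ℂ),
      hnp, hnp]
    rcases eq_or_ne n 1 with rfl | hn1'
    · simp
    have hl : 0 < Real.log n := Real.log_pos (by exact_mod_cast (by omega : 1 < n))
    have hl' : 0 < ‖((Real.log n : ℝ) : ℂ)‖ := by
      rw [norm_pos_iff]; exact_mod_cast hl.ne'
    gcongr
    exact hσ k

theorem tendsto_central_integral {v : ℝ → ℝ} {B t : ℝ}
    (hW : StripDecay (fun z => weightFT v (z / Complex.I)) B)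
    {σ : ℕ → ℝ} (hσ : ∀ n, 1 / 2 ≤ σ n) (hlim : Tendsto σ atTop (𝓝 (1 / 2))) :
    Tendsto (fun k => ∫ y in (-1 : ℝ)..1,
        logZeta (σ k + t * Complex.I + ((0 : ℝ) + y * Complex.I)) *
          weightFT v (((0 : ℝ) + y * Complex.I) / Complex.I)) atTop
      (𝓝 (∫ y in (-1 : ℝ)..1,
        logZeta ((1 / 2 : ℝ) + t * Complex.I + ((0 : ℝ) + y * Complex.I)) *
          weightFT v (((0 : ℝ) + y * Complex.I) / Complex.I))) := by
  have h01 : (0 : ℝ) ∈ Icc (0 : ℝ) 1 := ⟨le_rfl, zero_le_one⟩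
  have hae : ∀ᵐ y : ℝ, zetaMajorant (t + y) < ∞ :=
    (measurePreserving_add_left volume t).quasiMeasurePreserving.ae ae_zetaMajorant_lt_top
  have hm : Measurable fun y : ℝ => zetaMajorant (t + y) * ENNReal.ofReal (1 / (1 + y ^ 2)) :=
    (measurable_zetaMajorant.comp (by fun_prop)).mul (by fun_prop)
  refine intervalIntegral.tendsto_integral_filter_of_dominated_convergence
    (fun y => B * (zetaMajorant (t + y) * ENNReal.ofReal (1 / (1 + y ^ 2))).toReal) ?_ ?_ ?_ ?_
  · exact Eventually.of_forall fun k =>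
      (hW.integrable_logZeta_mul (t := t) (hσ k) h01).aestronglyMeasurable.restrict
  · refine Eventually.of_forall fun k => ?_
    filter_upwards [hae] with y hy _
    have h := StripDecay.enorm_logZeta_mul_le
      (W := fun z => weightFT v (z / Complex.I)) (t := t) (hσ k) le_rfl (hW.bound 0 h01 y)
    rw [ENNReal.ofReal_mul hW.nonneg, mul_left_comm] at h
    rw [← toReal_enorm]
    refine (ENNReal.toReal_mono (ENNReal.mul_ne_top ENNReal.ofReal_ne_top
      (ENNReal.mul_ne_top hy.ne ENNReal.ofReal_ne_top)) h).trans ?_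
    rw [ENNReal.toReal_mul, ENNReal.toReal_ofReal hW.nonneg]
  · exact ((integrable_toReal_of_lintegral_ne_top hm.aemeasurable
      (StripDecay.lintegral_weighted_ne_top t)).const_mul B).intervalIntegrable
  · filter_upwards [hae] with y hy _
    refine Tendsto.mul_const _ ?_
    have h := tendsto_logZeta_half hy hσ hlim
    have e : ∀ x : ℝ, (x : ℂ) + t * Complex.I + ((0 : ℝ) + y * Complex.I) =
        x + ((t + y : ℝ) : ℂ) * Complex.I := by
      intro x; push_cast; ring
    simp_rw [e]
    exact h

end LongSums

/-! ### Assembly of the theorem. -/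

open LongSums

theorem mainTheorem6 (hRH : RiemannHypothesis) (V : ℝ → ℝ → ℝ) (m : ℝ) (hm : 2 ≤ m)
    (hV : LongSums.WellDefinedWeights V) (hii : LongSums.VerticalDecay V m)
    (hiii : LongSums.Concentrated V) (ε : ℝ) (hε : 0 < ε) :
    ∃ C t₀ : ℝ, 0 < t₀ ∧ ∀ T t X σ : ℝ, t₀ ≤ t → t ∈ Set.Icc T (2 * T) →
      T ^ ε ≤ X → X ≤ T ^ (2 * m) → σ ∈ Set.Icc (1 / 2 : ℝ) 1 →
        Summable (LongSums.weightedTerm (V X) σ t) ∧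
        IntervalIntegrable
          (fun y : ℝ => LongSums.logZeta ((σ : ℂ) + Complex.I * ((y : ℂ) + t)) *
            LongSums.weightFT (V X) (y : ℂ)) MeasureTheory.volume (-1) 1 ∧
        ‖(∑' n : ℕ, LongSums.weightedTerm (V X) σ t n) -
            1 / (2 * (Real.pi : ℂ)) *
              ∫ y in (-1 : ℝ)..1, LongSums.logZeta ((σ : ℂ) + Complex.I * ((y : ℂ) + t)) *
                LongSums.weightFT (V X) (y : ℂ)‖ ≤ C := by
  obtain ⟨C₁, y₀, hC₁, hy₀, hdec⟩ := hii.exists_bound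
  obtain ⟨C₂, hC₂, hconc⟩ := hiii.exists_bound
  obtain ⟨C₃, hC₃, hC₃w⟩ := exists_lintegral_zetaMajorant_weighted_le
  obtain ⟨h, h1, h2, hfin, hfin'⟩ := exists_zetaMajorant_lt_top
  have hcen := lintegral_zetaMajorant_center_ne_top
  set P := C₁ * (Real.exp (2 * m) * 2 ^ m) with hP
  set A := (zetaMajorant h).toReal + (zetaMajorant (-h)).toReal +
        (∫⁻ w in Ioc (-2 : ℝ) 2, zetaMajorant w).toReal with hA
  set K := 1 / (2 * Real.pi) * (P * A + 3 * (C₂ * C₃ * (2 / ε))) with hK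
  -- The factor `2` passes from `t` to `T ≥ t / 2`. The summands ensure `log T ≥ 2` (so that `c ≤
  -- 1`), `X ≥ 2`, `|y| ≥ y₀` near the pole height, and `t ≥ 4`.
  refine ⟨K, 2 * (Real.exp 2 + 2 ^ (1 / ε) + y₀ + 4), by positivity, ?_⟩
  intro T t X σ ht₀ ht hX hX' hσ
  have hexp := Real.exp_pos 2
  have h2e : (0 : ℝ) < 2 ^ (1 / ε) := by positivity
  have hTe : Real.exp 2 ≤ T := by linarith [ht.2]
  have hT2 : 2 ^ (1 / ε) ≤ T := by linarith [ht.2]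
  have hT4 : 4 ≤ T := by linarith [ht.2]
  have hTy : y₀ + 4 ≤ T := by linarith [ht.2]
  have hTt : T ≤ t := ht.1
  have hT0 : 0 < T := by linarith
  have hlT : 2 ≤ Real.log T := (Real.le_log_iff_exp_le hT0).2 hTe
  have hX2 : 2 ≤ X := by
    refine le_trans ?_ hX
    calc (2 : ℝ) = (2 ^ (1 / ε)) ^ ε := by
          rw [← Real.rpow_mul (by norm_num), one_div_mul_cancel hε.ne', Real.rpow_one]
      _ ≤ T ^ ε := Real.rpow_le_rpow (by positivity) hT2 hε.le
  have hX0 : 0 < X := by linarith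
  have hlX : ε * Real.log T ≤ Real.log X := by
    rw [← Real.log_rpow hT0]; exact Real.log_le_log (by positivity) hX
  have hlX0 : 0 < Real.log X := Real.log_pos (by linarith)
  obtain ⟨hv, hint⟩ := hV X hX2
  obtain ⟨B, hB, hBW⟩ := exists_uniform_weight_bound hv hint hm (D := C₁ * X) (y₀ := y₀)
    (by positivity) hy₀ (fun u hu y hy => by
      refine (hdec X hX2 u hu y hy).trans ?_
      rw [mul_div_assoc]
      gcongr
      calc X ^ u ≤ X ^ (1 : ℝ) := Real.rpow_le_rpow_of_exponent_le (by linarith) hu.2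
        _ = X := Real.rpow_one X)
  have hW : StripDecay (fun z => weightFT (V X) (z / Complex.I)) B :=
    ⟨continuousOn_weightFT hv hint, fun z hz => differentiableAt_weightFT hv hint hz, hBW⟩
  have hsummable : ∀ σ : ℝ, 1 / 2 ≤ σ → Summable (weightedTerm (V X) σ t) := fun σ hσ =>
    (hasSum_weightedTerm hv hint hW (c := 1) ⟨zero_le_one, le_rfl⟩ (by linarith)).summable
  have hlog : Real.log (|t| + 2) / Real.log X ≤ 2 / ε := by
    have h3 : Real.log (|t| + 2) ≤ 2 * Real.log T := by
      have : 2 * Real.log T = Real.log (T ^ 2) := by rw [Real.log_pow]; norm_num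
      rw [this, abs_of_pos (by linarith)]
      apply Real.log_le_log (by linarith)
      nlinarith [ht.2]
    rw [div_le_div_iff₀ hlX0 hε]
    nlinarith
  have hmain : ∀ σ : ℝ, 1 / 2 < σ → σ ≤ 1 →
      ‖(∑' n : ℕ, weightedTerm (V X) σ t n) - 1 / (2 * (Real.pi : ℂ)) *
        ∫ y in (-1 : ℝ)..1, logZeta (σ + t * Complex.I + ((0 : ℝ) + y * Complex.I)) *
          weightFT (V X) (((0 : ℝ) + y * Complex.I) / Complex.I)‖ ≤ K := by
    intro σ hσ hσ1
    -- The line `Re (s + z) = 1 + 1 / log T` is inside absolute convergence, yet the excess `1 / log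
    -- T` costs only a bounded power of `X`.
    set c := 1 - σ + 1 / Real.log T with hc
    have hd0 : 0 < 1 / Real.log T := by positivity
    have hd1 : 1 / Real.log T ≤ 1 / 2 := by gcongr
    have hc0 : 0 ≤ c := by linarith
    have hc1 : c ≤ 1 := by linarith
    rw [(hasSum_weightedTerm hv hint hW (t := t) (c := c) ⟨hc0, hc1⟩ (by linarith)).tsum_eq,
      ← mul_sub, norm_mul]
    have hest := StripDecay.norm_integral_sub_integral_le hRH hW (t := t) (P := P)
      (Q := C₂ / Real.log X) hσ hc0 hc1 h1 h2 hfin hfin' hcen (by linarith)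
      (fun x hx y hy => by
        have hyy : y₀ ≤ |y| := by
          have h3 : -|y| ≤ y := neg_abs_le y
          have h4 := (abs_le.1 hy).2
          linarith
        refine (hdec X hX2 x ⟨hx.1, hx.2.trans hc1⟩ y hyy).trans ?_
        rw [hP]
        gcongr
        exact rpow_div_rpow_le (by linarith) hTe hT4 hTt (by linarith) hX' hσ.le hx.2 hy)
      (by positivity) (hconc X hX2)
    have hnorm : ‖(1 / (2 * (Real.pi : ℂ)))‖ = 1 / (2 * Real.pi) := by
      simp [abs_of_pos Real.pi_pos]
    rw [hnorm, hK]
    have hpi := Real.pi_pos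
    refine mul_le_mul_of_nonneg_left (hest.trans ?_) (by positivity)
    gcongr P * A + 3 * ?_
    have hJ : (∫⁻ y, zetaMajorant (t + y) * ENNReal.ofReal (1 / (1 + y ^ 2))).toReal ≤
        C₃ * Real.log (|t| + 2) := by
      have hl0 : 0 ≤ Real.log (|t| + 2) := Real.log_nonneg (by linarith [abs_nonneg t])
      refine (ENNReal.toReal_mono ENNReal.ofReal_ne_top (hC₃w t)).trans ?_
      rw [ENNReal.toReal_ofReal (by positivity)]
    calc C₂ / Real.log X *
          (∫⁻ y, zetaMajorant (t + y) * ENNReal.ofReal (1 / (1 + y ^ 2))).toReal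
        ≤ C₂ / Real.log X * (C₃ * Real.log (|t| + 2)) := by gcongr
      _ = C₂ * C₃ * (Real.log (|t| + 2) / Real.log X) := by ring
      _ ≤ _ := by gcongr
  simp_rw [central_integrand_eq]
  refine ⟨hsummable σ hσ.1, (hW.integrable_logZeta_mul hσ.1
    ⟨le_rfl, zero_le_one⟩).intervalIntegrable, ?_⟩
  rcases hσ.1.lt_or_eq with hlt | heq
  · exact hmain σ hlt hσ.2
  · rw [← heq]
    -- At `σ = 1/2` the contour could pass through zeros. Since `K` does not depend on `σ`, the
    -- bound survives the limit from the right.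
    set s : ℕ → ℝ := fun k => 1 / 2 + 1 / 2 * (1 / ((k : ℝ) + 1)) with hs
    have hs0 : ∀ k, 1 / 2 < s k := fun k => by
      have : 0 < 1 / ((k : ℝ) + 1) := by positivity
      simp only [hs]; linarith
    have hs1 : ∀ k, s k ≤ 1 := fun k => by
      have : 1 / ((k : ℝ) + 1) ≤ 1 := by
        rw [div_le_one (by positivity)]; linarith [k.cast_nonneg (α := ℝ)]
      simp only [hs]; linarith
    have hslim : Tendsto s atTop (𝓝 (1 / 2)) := by
      have := (tendsto_one_div_add_atTop_nhds_zero_nat (𝕜 := ℝ)).const_mul (1 / 2)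
      simpa [hs] using this.const_add (2⁻¹ : ℝ)
    have hlim := ((tendsto_tsum_weightedTerm (hsummable _ le_rfl) (fun k => (hs0 k).le) hslim).sub
      ((tendsto_central_integral (t := t) hW (fun k => (hs0 k).le) hslim).const_mul
        (1 / (2 * (Real.pi : ℂ))))).norm
    exact le_of_tendsto hlim (Eventually.of_forall fun k => hmain (s k) (hs0 k) (hs1 k))
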